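/- Let $\Omega\subset\mathbb R^d$ be a domain, i.e. a measurable set with nonempty connected interior and $\Omega\subset\overline{\operatorname{int}\Omega}$ (for instance a connected open set or its closure). Let $h:\mathbb R^d\to[0,\infty)$ be strictly convex, put $c(x,y)=h(x-y)$, and let $h^*(p)=\sup_z\,\langle z,p\rangle-h(z)$. Let $\mu,\nu$ be probability measures on $\Omega$. A transport plan is a measure $\gamma$ with marginals $\mu$ and $\nu$; it is optimal if it minimizes $\int c\,d\gamma$ among transport plans; a map $T$ is an optimal map from $\mu$ to $\nu$ if $(\mathrm{id}\times T)_\#\mu$ is an optimal plan. For $\psi:\Omega\to\mathbb R$ put $\psi^c(y)=\inf_{x\in\Omega}c(x,y)-\psi(x)$; $\psi$ is $c$-concave if $\psi(x)=\inf_{y\in\Omega}c(x,y)-\chi(y)$ on $\Omega$ for some $\chi:\Omega\to[-\infty,+\infty]$; a Kantorovich potential is a $c$-concave $\psi$ that maximizes $\int\psi\,d\mu+\int\psi^c\,d\nu$ among $c$-concave functions (with $\psi\in L^1(\mu)$, $\psi^c\in L^1(\nu)$). Gradients of functions on $\Omega$ are taken relative to $\Omega$ (the usual gradient at interior points). (1)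 There exists an optimal plan. Assume from now on that $\Omega$ is bounded. (2) There exists a Kantorovich potential. (3) If $\mu$ is absolutely continuous, the optimal plan is unique and of the form $(\mathrm{id}\times T)_\#\mu$ with $T$ measurable. For every Kantorovich potential $\psi$ and $\mu$-a.e. $x$: $\psi$ is differentiable at $x$, $h^*$ is finite near $\nabla\psi(x)$ and differentiable there, $T(x)=x-\nabla h^*(\nabla\psi(x))$, and $\psi(x)+\psi^c(T(x))=c(x,T(x))$. Any two Kantorovich potentials have the same gradient at $\mu$-a.e. $x$ such that $h$ is differentiable at $x-T(x)$; in particular, if $h$ is differentiable, $\nabla\psi$ is uniquely determined $\mu$-a.e. If $h$ is differentiable at $x-T(x)$ for $\mu$-a.e. $x$ (in particular if $h$ is differentiable) and the density of $\mu$ is positive a.e. on $\Omega$, then the Kantorovich potential is unique on $\Omega$ up to an additive constant. (4) Conversely, let $\psi$ be $c$-concave, and suppose that $\mu$ is absolutely continuous, or that $\mu$-a.e. point lies in the interior of $\Omega$ and is a point of differentiability of $\psi$. Then every map $T$ with $T(x)=x-\nabla h^*(\nabla\psi(x))$ for $\mu$-a.e. $x$ is an optimal map from $\mu$ to $T_\#\mu$.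 (5) (Brenier) If $\mu$ is absolutely continuous, then for the cost $|x-y|^2/2$ there is a convex $\varphi:\mathbb R^d\to\mathbb R$ such that $\nabla\varphi$ is an optimal map from $\mu$ to $\nu$; $\varphi=|x|^2/2-\psi$ on $\Omega$ for some Kantorovich potential $\psi$ for this cost, and $\nabla\varphi(x)=x-\nabla\psi(x)$ for $\mu$-a.e. $x$ for every such potential. Moreover $\nabla\varphi'=\nabla\varphi$ $\mu$-a.e. for every convex $\varphi':\mathbb R^d\to\mathbb R$ with $(\nabla\varphi')_\#\mu=\nu$. -/

import Mathlib

open MeasureTheory Set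
open scoped Gradient

namespace OptTransport

noncomputable section

/-- `ℝ^d` with its Euclidean norm and Lebesgue measure `volume`. -/
abbrev Space (d : ℕ) : Type := EuclideanSpace ℝ (Fin d)

/-- A domain, open or not: a measurable set lying between a nonempty connected open set
(its interior) and the closure of that open set. Open connected sets and their closures,
in particular compact domains, are the typical cases. -/
structure IsTransportDomain {d : ℕ} (Ω : Set (Space d)) : Prop where
  measurableSet : MeasurableSet Ω
  connected : IsConnected (interior Ω)
  subset_closure : Ω ⊆ closure (interior Ω)

/-- The cost `c(x, y) = h (x - y)`. -/
def diffCost {d : ℕ} (h : Space d → ℝ) (x y : Space d) : ℝ := h (x - y)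

/-- The quadratic profile `h z = |z|² / 2`. -/
def quadratic {d : ℕ} (z : Space d) : ℝ := ‖z‖ ^ 2 / 2

/-- `γ` is a transport plan from `μ` to `ν`: its two marginals are `μ` and `ν`. If `μ` and `ν` are
carried by `Ω`, then `γ` is carried by `Ω × Ω`. -/
def IsTransportPlan {d : ℕ} (μ ν : Measure (Space d)) (γ : Measure (Space d × Space d)) : Prop :=
  γ.map Prod.fst = μ ∧ γ.map Prod.snd = ν

/-- The total cost `∫ c dγ ∈ [0, ∞]` of a plan, for a nonnegative cost `c`. -/
def planCost {d : ℕ} (c : Space d → Space d → ℝ) (γ : Measure (Space d × Space d)) : ENNReal :=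
  ∫⁻ z, ENNReal.ofReal (c z.1 z.2) ∂γ

/-- `γ` solves the Kantorovich problem. -/
def IsOptimalPlan {d : ℕ} (c : Space d → Space d → ℝ) (μ ν : Measure (Space d))
    (γ : Measure (Space d × Space d)) : Prop :=
  IsTransportPlan μ ν γ ∧ ∀ γ', IsTransportPlan μ ν γ' → planCost c γ ≤ planCost c γ'

/-- The plan `(id × T)_# μ`. -/
def mapPlan {d : ℕ} (μ : Measure (Space d)) (T : Space d → Space d) :
    Measure (Space d × Space d) :=
  μ.map fun x => (x, T x)

/-- `T` is an optimal transport map from `μ` to `ν`. -/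
def IsOptimalMap {d : ℕ} (c : Space d → Space d → ℝ) (μ ν : Measure (Space d))
    (T : Space d → Space d) : Prop :=
  AEMeasurable T μ ∧ IsOptimalPlan c μ ν (mapPlan μ T)

/-- The `c`-transform `χ^c (y) = inf_{x ∈ Ω} c(x, y) - χ(x)` of an extended real function. -/
def cTransform {d : ℕ} (Ω : Set (Space d)) (c : Space d → Space d → ℝ) (χ : Space d → EReal)
    (y : Space d) : EReal :=
  ⨅ x ∈ Ω, ((c x y : ℝ) : EReal) - χ x

/-- A (finite) function `ψ` is `c`-concave on `Ω` if `ψ(x) = inf_{y ∈ Ω} c(x, y) - χ(y)` on `Ω` for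
some extended real function `χ`. For a symmetric cost this says `ψ = χ^c`; for other costs it is
the usual two-sided convention. Only the values of `ψ` on `Ω` matter. -/
def IsCConcave {d : ℕ} (Ω : Set (Space d)) (c : Space d → Space d → ℝ) (ψ : Space d → ℝ) : Prop :=
  ∃ χ : Space d → EReal, ∀ x ∈ Ω, (ψ x : EReal) = cTransform Ω (fun y x => c x y) χ x

/-- `ψ^c` for a real function `ψ`. -/
def cConj {d : ℕ} (Ω : Set (Space d)) (c : Space d → Space d → ℝ) (ψ : Space d → ℝ)
    (y : Space d) : EReal :=
  cTransform Ω c (fun x => (ψ x : EReal)) y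

/-- `ψ` is `c`-concave with `ψ ∈ L¹(μ)` and `ψ^c ∈ L¹(ν)`. -/
def IsDualAdmissible {d : ℕ} (Ω : Set (Space d)) (c : Space d → Space d → ℝ)
    (μ ν : Measure (Space d)) (ψ : Space d → ℝ) : Prop :=
  IsCConcave Ω c ψ ∧ Integrable ψ μ ∧
    (∀ᵐ y ∂ν, cConj Ω c ψ y ≠ ⊥ ∧ cConj Ω c ψ y ≠ ⊤) ∧
    Integrable (fun y => (cConj Ω c ψ y).toReal) ν

/-- The dual functional `∫ ψ dμ + ∫ ψ^c dν`. -/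
def dualValue {d : ℕ} (Ω : Set (Space d)) (c : Space d → Space d → ℝ)
    (μ ν : Measure (Space d)) (ψ : Space d → ℝ) : ℝ :=
  ∫ x, ψ x ∂μ + ∫ y, (cConj Ω c ψ y).toReal ∂ν

/-- Kantorovich potentials: the maximizers of the dual functional among `c`-concave functions. -/
def IsKantorovichPotential {d : ℕ} (Ω : Set (Space d)) (c : Space d → Space d → ℝ)
    (μ ν : Measure (Space d)) (ψ : Space d → ℝ) : Prop :=
  IsDualAdmissible Ω c μ ν ψ ∧
    ∀ φ, IsDualAdmissible Ω c μ ν φ → dualValue Ω c μ ν φ ≤ dualValue Ω c μ ν ψ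

/-- The set where the Legendre transform `h*` is finite. -/
def legendreDom {d : ℕ} (h : Space d → ℝ) : Set (Space d) :=
  {p | BddAbove (range fun z => inner ℝ z p - h z)}

/-- The Legendre transform `h*(p) = sup_z ⟨z, p⟩ - h(z)`, meaningful on `legendreDom h`. -/
def legendre {d : ℕ} (h : Space d → ℝ) (p : Space d) : ℝ :=
  ⨆ z, (inner ℝ z p - h z)

end

end OptTransport

/-! An optimal plan exists, even on unbounded `Ω`, because the set of plans is weakly compact and
the cost is lower semicontinuous. For bounded `Ω`, strong duality is not proved beforehand: for
absolutely continuous `μ` it comes out of a first variation of the dual problem.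

A `c`-concave `ψ` is replaced by its double transform `u`, which lives on the whole space and agrees
with `ψ` on `Ω`. As an infimum over a bounded set of vertically shifted translates of a convex
function, `u` is locally Lipschitz, hence differentiable a.e. At a point `x` of differentiability,
let `y` in the closure of `Ω` minimize `h (x - y) - ψ^c(y)`. Then `u` touches a translate of `h`
from below, so `∇u(x)` is a subgradient of `h` at `x - y`. Strict convexity makes `h*`
differentiable there with gradient `x - y`. So the minimizer is unique and equals `T(x) = x -
∇h*(∇u(x))` (`infTransform_eq_gradientMap`).

A maximizer of the dual functional exists by compactness of normalized Lipschitz functions.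
Perturbing `ψ^c` to `ψ^c + εg` changes `u` at rate `-g(T(x))`, and maximality, used for `g` and
`-g`, gives `T_#μ = ν` (`IsKantorovichPotential.map_gradientMap`). The pair `(u, ψ^c)` is tight
along the graph of `T`, so `T` is optimal; any other optimal plan is then tight as well, and
uniqueness of the minimizer puts it on the same graph.

Gradients of two potentials are both subgradients of `h` at `x - T(x)`, so they coincide where `h`
is differentiable; a locally Lipschitz function with a.e. vanishing gradient on a connected open set
is constant. For the quadratic cost `|x|²/2 - u` is convex. Conversely the gradient of a convex
function is optimal onto its image, so Brenier uniqueness follows from uniqueness of the optimal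
plan. -/

namespace OptTransport

open Filter Topology Metric
open scoped Pointwise NNReal

/-! ### Density points, Rademacher's theorem, and functions with a.e. zero differential. -/

section Differentiation

variable {E : Type*} [NormedAddCommGroup E] [NormedSpace ℝ E] [FiniteDimensional ℝ E]
  [MeasurableSpace E] [BorelSpace E]

/-- Almost every point of a measurable set is a point of unique differentiability: at a density
point the tangent cone is the whole space. -/
theorem ae_restrict_uniqueDiffWithinAt (μ : Measure E) [μ.IsAddHaarMeasure] {s : Set E}
    (hs : MeasurableSet s) : ∀ᵐ x ∂μ.restrict s, UniqueDiffWithinAt ℝ s x := by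
  filter_upwards [Besicovitch.ae_tendsto_measure_inter_div μ s, ae_restrict_mem hs] with x hx xs
  refine ⟨?_, subset_closure xs⟩
  have key : ∀ z : E, z ∈ tangentConeAt ℝ s x := by
    intro z
    have : ∀ n : ℕ, ∃ r : ℝ, ∃ a : E, 0 < r ∧ r < 1 / (n + 1) ∧ dist a z ≤ 1 / (n + 1) ∧
        x + r • a ∈ s := by
      intro n
      have hn : (0 : ℝ) < 1 / (n + 1) := by positivity
      -- At a density point every sufficiently small homothetic copy of a ball around `z` meets `s`;
      -- this produces points of `s` approaching `x` in the direction `z`.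
      have B₁ : ∀ᶠ r in 𝓝[>] (0 : ℝ), (s ∩ ({x} + r • closedBall z (1 / (n + 1)))).Nonempty :=
        Measure.eventually_nonempty_inter_smul_of_density_one μ s x hx _ measurableSet_closedBall
          (measure_closedBall_pos μ z hn).ne'
      obtain ⟨r, ⟨y, ys, hy⟩, hr⟩ := (B₁.and (Ioo_mem_nhdsGT hn)).exists
      simp only [mem_smul_set, image_add_left, mem_preimage, singleton_add] at hy
      obtain ⟨a, az, ha⟩ := hy
      refine ⟨r, a, hr.1, hr.2, az, ?_⟩
      rw [ha]
      simpa using ys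
    choose r a hr0 hr1 ha hs using this
    have h0 : Tendsto (fun n : ℕ => 1 / ((n : ℝ) + 1)) atTop (𝓝 0) :=
      tendsto_one_div_add_atTop_nhds_zero_nat
    have hr : Tendsto r atTop (𝓝 0) :=
      squeeze_zero (fun n => (hr0 n).le) (fun n => (hr1 n).le) h0
    have haz : Tendsto a atTop (𝓝 z) :=
      tendsto_iff_dist_tendsto_zero.2 (squeeze_zero (fun n => dist_nonneg) ha h0)
    refine mem_tangentConeAt_of_seq atTop (fun n => (r n)⁻¹) (fun n => r n • a n) ?_
      (Eventually.of_forall hs) ?_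
    · simpa using hr.smul haz
    · refine haz.congr fun n => ?_
      rw [smul_smul, inv_mul_cancel₀ (hr0 n).ne', one_smul]
  rw [show tangentConeAt ℝ s x = univ from eq_univ_of_forall key]
  simp

theorem ae_differentiableAt_of_locallyLipschitz {f : E → ℝ} (μ : Measure E) [μ.IsAddHaarMeasure]
    (hf : LocallyLipschitz f) : ∀ᵐ x ∂μ, DifferentiableAt ℝ f x := by
  have : ∀ n : ℕ, ∀ᵐ x ∂μ, x ∈ ball (0 : E) n → DifferentiableAt ℝ f x := by
    intro n
    obtain ⟨K, hK⟩ := LocallyLipschitzOn.exists_lipschitzOnWith_of_compact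
      (isCompact_closedBall (0 : E) n) hf.locallyLipschitzOn
    filter_upwards [(hK.mono ball_subset_closedBall).ae_differentiableWithinAt_of_mem (μ := μ)]
      with x hx hxn
    exact (hx hxn).differentiableAt (isOpen_ball.mem_nhds hxn)
  filter_upwards [ae_all_iff.2 this] with x hx
  obtain ⟨n, hn⟩ := exists_nat_gt ‖x‖
  exact hx n (by simpa using hn)

/-- A locally Lipschitz function whose differential vanishes almost everywhere on a connected open
set is constant there. -/
theorem exists_eq_const_of_ae_hasFDerivAt_zero {f : E → ℝ} (μ : Measure E)
    [μ.IsAddHaarMeasure] (hf : LocallyLipschitz f) {U : Set E} (hU : IsOpen U)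
    (hUc : IsPreconnected U) (hd : ∀ᵐ x ∂μ, x ∈ U → HasFDerivAt f (0 : E →L[ℝ] ℝ) x) :
    ∃ C, ∀ x ∈ U, f x = C := by
  have hloc : ∀ x₀ ∈ U, ∃ r > 0, ∀ v, ‖v‖ < r → f (x₀ + v) = f x₀ := by
    intro x₀ hx₀
    obtain ⟨R, hR, hball⟩ := Metric.isOpen_iff.1 hU x₀ hx₀
    refine ⟨R / 2, by positivity, fun v hv => ?_⟩
    obtain ⟨N, hsub, hNm, hN0⟩ := exists_measurable_superset_of_null (ae_iff.1 hd)
    have hN : ∀ x, x ∉ N → x ∈ U → HasFDerivAt f (0 : E →L[ℝ] ℝ) x := by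
      intro x hx
      by_contra hcon
      exact hx (hsub hcon)
    -- Fubini: almost every segment in direction `v` meets the exceptional null set `N` only for a
    -- null set of parameters. Along it `f` is absolutely continuous with zero derivative, so `f (x
    -- + v) = f x`.
    have h1 : ∀ᵐ t : ℝ, ∀ᵐ x ∂μ, x + t • v ∉ N := by
      refine Eventually.of_forall fun t => ?_
      have : μ ((fun x => x + t • v) ⁻¹' N) = 0 := by rw [measure_preimage_add_right, hN0]
      rw [ae_iff]
      simp only [not_not]
      exact this
    have h2 : ∀ᵐ x ∂μ, ∀ᵐ t : ℝ, x + t • v ∉ N := by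
      refine (Measure.ae_ae_comm (p := fun (t : ℝ) (x : E) => x + t • v ∉ N) ?_).1 h1
      have hm : Measurable fun p : ℝ × E => p.2 + p.1 • v := by fun_prop
      exact (hm hNm).compl
    have h3 : (fun x => f (x + v)) =ᵐ[μ.restrict (ball x₀ (R / 2))] f := by
      filter_upwards [ae_restrict_of_ae h2, ae_restrict_mem measurableSet_ball] with x hx hxb
      have hxU : ∀ t ∈ Icc (0 : ℝ) 1, x + t • v ∈ U := by
        intro t ht
        apply hball
        rw [mem_ball, dist_eq_norm] at hxb ⊢
        calc ‖x + t • v - x₀‖ = ‖(x - x₀) + t • v‖ := by congr 1; abel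
          _ ≤ ‖x - x₀‖ + ‖t • v‖ := norm_add_le _ _
          _ ≤ ‖x - x₀‖ + 1 * ‖v‖ := by
              rw [norm_smul, Real.norm_of_nonneg ht.1]; gcongr; exact ht.2
          _ < R := by linarith
      have hlip : LocallyLipschitz fun t : ℝ => f (x + t • v) :=
        hf.comp ((contDiff_const.add (contDiff_id.smul contDiff_const) :
          ContDiff ℝ 1 fun t : ℝ => x + t • v).locallyLipschitz)
      obtain ⟨K, hK⟩ := LocallyLipschitzOn.exists_lipschitzOnWith_of_compact
        (isCompact_uIcc (a := (0 : ℝ)) (b := 1)) hlip.locallyLipschitzOn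
      obtain ⟨C, hC⟩ := hK.absolutelyContinuousOnInterval.const_of_ae_hasDerivAt_zero (by
        filter_upwards [hx] with t ht htI
        rw [uIcc_of_le zero_le_one] at htI
        have h4 := hN _ ht (hxU t htI)
        have h5 : HasDerivAt (fun t : ℝ => x + t • v) v t := by
          simpa using ((hasDerivAt_id t).smul_const v).const_add x
        simpa [Function.comp_def] using h4.comp_hasDerivAt t h5)
      have e0 := hC 0 (by simp)
      have e1 := hC 1 (by simp)
      simp only [zero_smul, add_zero, one_smul] at e0 e1
      simp only [e0, e1]
    have hc := hf.continuous
    -- Both sides are continuous, so the a.e. identity holds at every point of the ball, in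
    -- particular at its center.
    exact Measure.eqOn_open_of_ae_eq h3 isOpen_ball (by fun_prop) hc.continuousOn
      (mem_ball_self (by positivity))
  have hz : ∀ x ∈ U, HasFDerivAt f (0 : E →L[ℝ] ℝ) x := by
    intro x hx
    obtain ⟨r, hr, h⟩ := hloc x hx
    refine (hasFDerivAt_const (f x) x).congr_of_eventuallyEq ?_
    filter_upwards [ball_mem_nhds x hr] with y hy
    simpa using h (y - x) (by simpa [dist_eq_norm] using hy)
  exact hU.exists_is_const_of_fderiv_eq_zero hUc
    (fun x hx => (hz x hx).differentiableAt.differentiableWithinAt) fun x hx => (hz x hx).fderiv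

end Differentiation

/-! ### Subgradients of a strictly convex function and differentiability of its Legendre transform.
-/

section Subgradient

variable {d : ℕ}

/-- `p` is a subgradient of `h` at `z`. -/
def IsSubgradient (h : Space d → ℝ) (p z : Space d) : Prop :=
  ∀ v, h z + inner ℝ p v ≤ h (z + v)

/-- A function touching a convex function from below has its gradient in the subdifferential. -/
theorem isSubgradient_of_touching {h u : Space d → ℝ} (hh : ConvexOn ℝ univ h) {x z p : Space d}
    (hu : HasGradientAt u p x) (htouch : ∀ v, u (x + v) - u x ≤ h (z + v) - h z) :
    IsSubgradient h p z := by
  intro v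
  have h1 : HasDerivAt (fun t : ℝ => u (x + t • v)) (inner ℝ p v) 0 := by
    have h5 : HasDerivAt (fun t : ℝ => x + t • v) v 0 := by
      simpa using ((hasDerivAt_id (0 : ℝ)).smul_const v).const_add x
    have h6 : HasFDerivAt u (InnerProductSpace.toDual ℝ (Space d) p) (x + (0 : ℝ) • v) := by
      simpa using hu.hasFDerivAt
    simpa [Function.comp_def] using h6.comp_hasDerivAt (0 : ℝ) h5
  have h2 := h1.tendsto_slope_zero_right
  have h3 : inner ℝ p v ≤ h (z + v) - h z := by
    refine le_of_tendsto h2 ?_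
    filter_upwards [Ioc_mem_nhdsGT (zero_lt_one' ℝ)] with t ht
    simp only [zero_add, zero_smul, add_zero, smul_eq_mul]
    rw [inv_mul_le_iff₀ ht.1]
    refine (htouch (t • v)).trans ?_
    -- By convexity the difference quotients of `h` with step `t ≤ 1` are bounded by the one with
    -- step `1`.
    have := hh.2 (mem_univ z) (mem_univ (z + v)) (sub_nonneg.2 ht.2) ht.1.le (by ring)
    simp only [smul_eq_mul] at this
    have e : (1 - t) • z + t • (z + v) = z + t • v := by module
    rw [e] at this
    linarith
  linarith

theorem IsSubgradient.eq_gradient {h : Space d → ℝ} {p z : Space d} (hp : IsSubgradient h p z)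
    (hd : DifferentiableAt ℝ h z) : p = ∇ h z := by
  have h1 : IsLocalMin (fun w => h w - inner ℝ p w) z := by
    refine Eventually.of_forall fun w => ?_
    have := hp (w - z)
    rw [inner_sub_right] at this
    simp only [add_sub_cancel] at this
    linarith
  have h2 : HasFDerivAt (fun w => h w - inner ℝ p w)
      (fderiv ℝ h z - InnerProductSpace.toDual ℝ (Space d) p) z :=
    hd.hasFDerivAt.sub (InnerProductSpace.toDual ℝ (Space d) p).hasFDerivAt
  have h3 := h1.hasFDerivAt_eq_zero h2
  rw [sub_eq_zero] at h3
  rw [gradient, h3]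
  simp

/-- A strictly convex function grows linearly away from its supporting hyperplane. -/
theorem IsSubgradient.exists_growth {h : Space d → ℝ} (hh : StrictConvexOn ℝ univ h)
    {p z : Space d} (hp : IsSubgradient h p z) {r : ℝ} (hr : 0 < r) :
    ∃ δ > 0, ∀ w, r ≤ ‖w‖ → δ * ‖w‖ ≤ h (z + w) - h z - inner ℝ p w := by
  have hc : Continuous h := hh.convexOn.locallyLipschitz.continuous
  set g : Space d → ℝ := fun w => h (z + w) - h z - inner ℝ p w with hg
  have hgc : Continuous g := by fun_prop
  have hg0 : ∀ w, 0 ≤ g w := fun w => by have := hp w; simp only [hg]; linarith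
  have hgpos : ∀ w, w ≠ 0 → 0 < g w := by
    intro w hw
    have h1 := hh.2 (mem_univ z) (mem_univ (z + w)) (by simpa using hw)
      (by norm_num : (0 : ℝ) < 1 / 2) (by norm_num : (0 : ℝ) < 1 / 2) (by norm_num)
    have e : (1 / 2 : ℝ) • z + (1 / 2 : ℝ) • (z + w) = z + (1 / 2 : ℝ) • w := by module
    rw [e] at h1
    have h2 := hp ((1 / 2 : ℝ) • w)
    rw [inner_smul_right] at h2
    simp only [smul_eq_mul] at h1
    simp only [hg]
    linarith
  obtain ⟨m, hm, hmin⟩ : ∃ m > 0, ∀ w ∈ sphere (0 : Space d) r, m ≤ g w := by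
    rcases (sphere (0 : Space d) r).eq_empty_or_nonempty with he | hne
    -- The sphere is empty when `d = 0`.
    · exact ⟨1, one_pos, by simp [he]⟩
    · obtain ⟨w, hw, hwm⟩ := (isCompact_sphere (0 : Space d) r).exists_isMinOn hne hgc.continuousOn
      refine ⟨g w, hgpos w ?_, fun w' hw' => hwm hw'⟩
      rintro rfl
      simp at hw
      exact hr.ne hw
  refine ⟨m / r, by positivity, fun w hw => ?_⟩
  have hwpos : 0 < ‖w‖ := hr.trans_le hw
  have h1 := hmin ((r / ‖w‖) • w) (by
    rw [mem_sphere_zero_iff_norm, norm_smul, Real.norm_of_nonneg (by positivity)]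
    field_simp)
  have ht1 : r / ‖w‖ ≤ 1 := (div_le_one hwpos).2 hw
  -- The minimum over the sphere spreads outwards: by convexity the gap at radius `‖w‖` is at least
  -- `‖w‖ / r` times the gap at radius `r`.
  have h2 := hh.convexOn.2 (mem_univ z) (mem_univ (z + w)) (sub_nonneg.2 ht1)
    (by positivity : 0 ≤ r / ‖w‖) (by ring)
  have e : (1 - r / ‖w‖) • z + (r / ‖w‖) • (z + w) = z + (r / ‖w‖) • w := by module
  rw [e] at h2
  simp only [smul_eq_mul] at h2
  simp only [hg, inner_smul_right] at h1
  have h3 : m ≤ (r / ‖w‖) * (h (z + w) - h z - inner ℝ p w) := by linarith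
  rw [div_mul_eq_mul_div, le_div_iff₀ hwpos] at h3
  rw [div_mul_eq_mul_div, div_le_iff₀ hr]
  linarith

/-- Near a subgradient `p` of a strictly convex function at `z`, the Legendre transform is finite,
and it is differentiable at `p` with gradient `z`. -/
theorem IsSubgradient.legendre {h : Space d → ℝ} (hh : StrictConvexOn ℝ univ h)
    {p z : Space d} (hp : IsSubgradient h p z) :
    p ∈ interior (legendreDom h) ∧ HasGradientAt (legendre h) z p := by
  -- This bound is a first-order upper expansion of `h*` at `p`. Far from `z` the linear growth of
  -- `h` absorbs the perturbation `q - p`; within distance `r` of `z` the error is at most `r * ‖q -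
  -- p‖`. The matching lower expansion comes from the competitor `z`.
  have key : ∀ r > 0, ∃ δ > 0, ∀ q ∈ ball p δ, ∀ w,
      inner ℝ w q - h w ≤ inner ℝ z p - h z + inner ℝ z (q - p) + r * ‖q - p‖ := by
    intro r hr
    obtain ⟨δ, hδ, hgrow⟩ := hp.exists_growth hh hr
    refine ⟨δ, hδ, fun q hq w => ?_⟩
    rw [mem_ball, dist_eq_norm] at hq
    obtain ⟨v, rfl⟩ : ∃ v, w = z + v := ⟨w - z, by abel⟩
    have hqv : inner ℝ v (q - p) ≤ ‖v‖ * ‖q - p‖ := real_inner_le_norm _ _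
    have e1 : inner ℝ (z + v) q = inner ℝ z p + inner ℝ z (q - p) + inner ℝ p v
        + inner ℝ v (q - p) := by
      rw [inner_sub_right, inner_sub_right, inner_add_left, real_inner_comm v p]; ring
    rcases le_total r ‖v‖ with hv | hv
    · have h1 := hgrow v hv
      have h2 : ‖v‖ * ‖q - p‖ ≤ δ * ‖v‖ := by rw [mul_comm]; gcongr
      have h3 : 0 ≤ r * ‖q - p‖ := by positivity
      linarith
    · have h1 := hp v
      have h2 : ‖v‖ * ‖q - p‖ ≤ r * ‖q - p‖ := by gcongr
      linarith
  have hbdd : ∃ δ > 0, ball p δ ⊆ legendreDom h := by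
    obtain ⟨δ, hδ, hk⟩ := key 1 one_pos
    refine ⟨δ, hδ, fun q hq => ⟨inner ℝ z p - h z + inner ℝ z (q - p) + 1 * ‖q - p‖, ?_⟩⟩
    rintro _ ⟨w, rfl⟩
    exact hk q hq w
  obtain ⟨δ₀, hδ₀, hsub⟩ := hbdd
  have hleg : OptTransport.legendre h p = inner ℝ z p - h z := by
    refine le_antisymm (ciSup_le fun w => ?_) (le_ciSup (f := fun z => inner ℝ z p - h z)
      (hsub (mem_ball_self hδ₀)) z)
    have := hp (w - z)
    rw [inner_sub_right, add_sub_cancel, real_inner_comm w p, real_inner_comm z p] at this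
    linarith
  refine ⟨mem_interior.2 ⟨_, hsub, isOpen_ball, mem_ball_self hδ₀⟩, ?_⟩
  rw [hasGradientAt_iff_isLittleO, Asymptotics.isLittleO_iff]
  intro r hr
  obtain ⟨δ, hδ, hk⟩ := key r hr
  filter_upwards [ball_mem_nhds p hδ, ball_mem_nhds p hδ₀] with q hq hq₀
  have hup : OptTransport.legendre h q ≤
      inner ℝ z p - h z + inner ℝ z (q - p) + r * ‖q - p‖ := ciSup_le fun w => hk q hq w
  have hlo : inner ℝ z q - h z ≤ OptTransport.legendre h q :=
    le_ciSup (f := fun z => inner ℝ z q - h z) (hsub hq₀) z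
  have e : inner ℝ z (q - p) = inner ℝ z q - inner ℝ z p := inner_sub_right _ _ _
  rw [Real.norm_eq_abs, abs_le, hleg]
  constructor <;> nlinarith [mul_nonneg hr.le (norm_nonneg (q - p))]

end Subgradient

/-! ### Real-valued transforms over a bounded set. -/

noncomputable section

variable {d : ℕ}

/-- The real-valued transform `x ↦ inf_{y ∈ S} h (x - y) - f y`. -/
def infTransform (h : Space d → ℝ) (S : Set (Space d)) (f : Space d → ℝ) (x : Space d) : ℝ :=
  ⨅ y : S, (h (x - y) - f y)

/-- The reflected profile, which exchanges the two variables of the cost. -/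
def reflect (h : Space d → ℝ) (z : Space d) : ℝ := h (-z)

theorem reflect_sub (h : Space d → ℝ) (x y : Space d) : reflect h (y - x) = h (x - y) := by
  simp [reflect]

theorem convexOn_reflect {h : Space d → ℝ} (hh : ConvexOn ℝ univ h) :
    ConvexOn ℝ univ (reflect h) := by
  refine ⟨convex_univ, fun x _ y _ a b ha hb hab => ?_⟩
  have := hh.2 (mem_univ (-x)) (mem_univ (-y)) ha hb hab
  have e : a • -x + b • -y = -(a • x + b • y) := by module
  rwa [e] at this

theorem exists_lipschitzOnWith_closedBall {h : Space d → ℝ} (hh : ConvexOn ℝ univ h) (R : ℝ) :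
    ∃ L : ℝ≥0, LipschitzOnWith L h (closedBall 0 R) :=
  LocallyLipschitzOn.exists_lipschitzOnWith_of_compact (isCompact_closedBall _ _)
    hh.locallyLipschitz.locallyLipschitzOn

theorem bddAbove_image_of_continuous {S : Set (Space d)} (hS : Bornology.IsBounded S)
    {f : Space d → ℝ} (hf : Continuous f) : BddAbove (f '' S) :=
  ((hS.isCompact_closure.image hf).bddAbove).mono (image_mono subset_closure)

theorem bddBelow_image_of_continuous {S : Set (Space d)} (hS : Bornology.IsBounded S)
    {f : Space d → ℝ} (hf : Continuous f) : BddBelow (f '' S) :=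
  ((hS.isCompact_closure.image hf).bddBelow).mono (image_mono subset_closure)

section Transform

variable {h : Space d → ℝ} {S : Set (Space d)} {f : Space d → ℝ}

theorem bddBelow_infTransform (hh : Continuous h) (hS : Bornology.IsBounded S)
    (hf : BddAbove (f '' S)) (x : Space d) : BddBelow (range fun y : S => h (x - y) - f y) := by
  obtain ⟨m, hm⟩ := bddBelow_image_of_continuous hS (f := fun y => h (x - y)) (by fun_prop)
  obtain ⟨M, hM⟩ := hf
  refine ⟨m - M, ?_⟩
  rintro _ ⟨y, rfl⟩
  have h1 := hm (mem_image_of_mem _ y.2)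
  have h2 := hM (mem_image_of_mem _ y.2)
  simp only at h1 ⊢
  linarith

theorem infTransform_le (hh : Continuous h) (hS : Bornology.IsBounded S)
    (hf : BddAbove (f '' S)) (x : Space d) {y : Space d} (hy : y ∈ S) :
    infTransform h S f x ≤ h (x - y) - f y :=
  ciInf_le (bddBelow_infTransform hh hS hf x) (⟨y, hy⟩ : S)

theorem le_infTransform (hne : S.Nonempty) {a : ℝ} {x : Space d}
    (ha : ∀ y ∈ S, a ≤ h (x - y) - f y) : a ≤ infTransform h S f x :=
  haveI := hne.to_subtype
  le_ciInf fun y : S => ha y y.2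

theorem infTransform_congr {f g : Space d → ℝ} (hfg : ∀ y ∈ S, f y = g y) (x : Space d) :
    infTransform h S f x = infTransform h S g x := by
  unfold infTransform
  congr 1
  ext y
  rw [hfg y y.2]

/-- Transforms of functions bounded above are Lipschitz on balls, uniformly in the function. -/
theorem exists_lipschitzOnWith_infTransform (hh : ConvexOn ℝ univ h)
    (hS : Bornology.IsBounded S) (hne : S.Nonempty) (R : ℝ) :
    ∃ L : ℝ≥0, ∀ f : Space d → ℝ, BddAbove (f '' S) →
      LipschitzOnWith L (infTransform h S f) (closedBall 0 R) := by
  obtain ⟨R', hR'⟩ := hS.subset_closedBall (0 : Space d)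
  obtain ⟨L, hL⟩ := exists_lipschitzOnWith_closedBall hh (R + R')
  have hc := hh.locallyLipschitz.continuous
  refine ⟨L, fun f hf => LipschitzOnWith.of_le_add_mul L fun x hx x' hx' => ?_⟩
  rw [← sub_le_iff_le_add]
  refine le_infTransform hne fun y hy => ?_
  have h1 := infTransform_le hc hS hf x hy
  have hmem : ∀ x ∈ closedBall (0 : Space d) R, x - y ∈ closedBall (0 : Space d) (R + R') := by
    intro x hx
    have hy' := hR' hy
    rw [mem_closedBall_zero_iff] at hx hy' ⊢
    exact (norm_sub_le _ _).trans (add_le_add hx hy')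
  have h2 := hL.le_add_mul (hmem x hx) (hmem x' hx')
  rw [dist_sub_right] at h2
  linarith

theorem locallyLipschitz_infTransform (hh : ConvexOn ℝ univ h)
    (hS : Bornology.IsBounded S) (hne : S.Nonempty) (hf : BddAbove (f '' S)) :
    LocallyLipschitz (infTransform h S f) := by
  intro x
  obtain ⟨L, hL⟩ := exists_lipschitzOnWith_infTransform hh hS hne (‖x‖ + 1)
  refine ⟨L, _, ?_, hL f hf⟩
  refine mem_of_superset (ball_mem_nhds x one_pos) fun y hy => ?_
  rw [mem_ball, dist_eq_norm] at hy
  rw [mem_closedBall_zero_iff]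
  calc ‖y‖ = ‖x + (y - x)‖ := by congr 1; abel
    _ ≤ ‖x‖ + ‖y - x‖ := norm_add_le _ _
    _ ≤ ‖x‖ + 1 := by linarith

theorem continuous_infTransform (hh : ConvexOn ℝ univ h)
    (hS : Bornology.IsBounded S) (hne : S.Nonempty) (hf : BddAbove (f '' S)) :
    Continuous (infTransform h S f) :=
  (locallyLipschitz_infTransform hh hS hne hf).continuous

/-- The inequality is a closed condition on `y`. This extension is needed because `S` need not be
closed, so minimizers are only found in `closure S`. -/
theorem infTransform_le_of_mem_closure (hh : Continuous h) (hS : Bornology.IsBounded S)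
    (hf : Continuous f) (x : Space d) {y : Space d} (hy : y ∈ closure S) :
    infTransform h S f x ≤ h (x - y) - f y := by
  have hcl : IsClosed {y | infTransform h S f x ≤ h (x - y) - f y} :=
    isClosed_le continuous_const (by fun_prop)
  exact closure_minimal
    (fun y hy => infTransform_le hh hS (bddAbove_image_of_continuous hS hf) x hy) hcl hy

theorem exists_infTransform_eq (hh : Continuous h) (hS : Bornology.IsBounded S)
    (hne : S.Nonempty) (hf : Continuous f) (x : Space d) :
    ∃ y ∈ closure S, infTransform h S f x = h (x - y) - f y := by
  obtain ⟨y, hy, hmin⟩ := hS.isCompact_closure.exists_isMinOn hne.closure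
    (f := fun y => h (x - y) - f y) (by fun_prop)
  exact ⟨y, hy, le_antisymm (infTransform_le_of_mem_closure hh hS hf x hy)
    (le_infTransform hne fun y' hy' => hmin (subset_closure hy'))⟩

/-- Transforms are nonexpansive for the uniform distance. -/
theorem infTransform_le_add (hh : Continuous h) (hS : Bornology.IsBounded S) (hne : S.Nonempty)
    {f g : Space d → ℝ} (hf : BddAbove (f '' S)) {a : ℝ} (hfg : ∀ y ∈ S, g y ≤ f y + a)
    (x : Space d) : infTransform h S f x ≤ infTransform h S g x + a := by
  rw [← sub_le_iff_le_add]
  refine le_infTransform hne fun y hy => ?_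
  have h1 := infTransform_le hh hS hf x hy
  have h2 := hfg y hy
  linarith

theorem bddAbove_image_reflect_infTransform (hh : ConvexOn ℝ univ h)
    (hS : Bornology.IsBounded S) (hne : S.Nonempty) (hf : BddAbove (f '' S)) :
    BddAbove (infTransform (reflect h) S f '' S) :=
  bddAbove_image_of_continuous hS (continuous_infTransform (convexOn_reflect hh) hS hne hf)

theorem le_infTransform_infTransform (hh : ConvexOn ℝ univ h)
    (hS : Bornology.IsBounded S) (hne : S.Nonempty) (hf : BddAbove (f '' S)) {x : Space d}
    (hx : x ∈ S) : f x ≤ infTransform h S (infTransform (reflect h) S f) x := by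
  refine le_infTransform hne fun y hy => ?_
  have := infTransform_le (convexOn_reflect hh).locallyLipschitz.continuous hS hf y hx
  rw [reflect_sub] at this
  linarith

/-- The extended-real transform of a real function bounded above is the real one. -/
theorem cTransform_coe (hh : Continuous h) (hS : Bornology.IsBounded S) (hne : S.Nonempty)
    (hf : BddAbove (f '' S)) (x : Space d) :
    cTransform S (fun y x => diffCost h x y) (fun y => (f y : EReal)) x
      = (infTransform h S f x : EReal) := by
  refine le_antisymm ?_ ?_
  · refine le_of_forall_gt_imp_ge_of_dense fun b hb => ?_
    induction b with
    | bot => exact absurd hb (by simp)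
    | top => exact le_top
    | coe b =>
      have hb' := EReal.coe_lt_coe_iff.1 hb
      have := hne.to_subtype
      obtain ⟨y, hy⟩ := exists_lt_of_ciInf_lt hb'
      refine (iInf₂_le (y : Space d) y.2).trans ?_
      simp only [diffCost]
      exact_mod_cast hy.le
  · refine le_iInf₂ fun y hy => ?_
    have := infTransform_le hh hS hf x hy
    simp only [diffCost]
    exact_mod_cast this

theorem cConj_eq (hh : ConvexOn ℝ univ h) (hS : Bornology.IsBounded S) (hne : S.Nonempty)
    (hf : BddAbove (f '' S)) (y : Space d) :
    cConj S (diffCost h) f y = (infTransform (reflect h) S f y : EReal) := by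
  rw [← cTransform_coe (convexOn_reflect hh).locallyLipschitz.continuous hS hne hf]
  simp only [cConj, cTransform, diffCost, reflect_sub]

theorem isCConcave_infTransform (hh : Continuous h) (hS : Bornology.IsBounded S)
    (hne : S.Nonempty) (hf : BddAbove (f '' S)) :
    IsCConcave S (diffCost h) (infTransform h S f) :=
  ⟨fun y => (f y : EReal), fun x _ => (cTransform_coe hh hS hne hf x).symm⟩

/-- Finiteness of `ψ` excludes `χ = ⊥` on all of `S` (then `ψ` would be `⊤`) and `χ y = ⊤` (then `ψ`
would be `⊥`). A single `y` with finite `χ y` bounds `ψ` by a continuous function on a bounded set.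
-/
theorem IsCConcave.bddAbove (hh : Continuous h) (hS : Bornology.IsBounded S) (hne : S.Nonempty)
    {ψ : Space d → ℝ} (hψ : IsCConcave S (diffCost h) ψ) : BddAbove (ψ '' S) := by
  obtain ⟨χ, hχ⟩ := hψ
  obtain ⟨x₀, hx₀⟩ := hne
  have hle : ∀ x ∈ S, ∀ y ∈ S, (ψ x : EReal) ≤ (h (x - y) : EReal) - χ y := fun x hx y hy => by
    rw [hχ x hx]; exact iInf₂_le y hy
  have : ∃ y ∈ S, χ y ≠ ⊥ := by
    by_contra! hcon
    have h1 : (ψ x₀ : EReal) = ⊤ := by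
      rw [hχ x₀ hx₀, cTransform]
      exact iInf₂_eq_top.2 fun y hy => by rw [hcon y hy]; simp [diffCost]
    exact EReal.coe_ne_top _ h1
  obtain ⟨y, hy, hyb⟩ := this
  have hyt : χ y ≠ ⊤ := by
    intro ht
    have h1 := hle x₀ hx₀ y hy
    rw [ht] at h1
    simp at h1
  lift χ y to ℝ using ⟨hyt, hyb⟩ with r hr
  obtain ⟨M, hM⟩ := bddAbove_image_of_continuous hS (f := fun x => h (x - y)) (by fun_prop)
  refine ⟨M - r, ?_⟩
  rintro _ ⟨x, hx, rfl⟩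
  have h1 := hle x hx y hy
  rw [← hr] at h1
  have h2 : ψ x ≤ h (x - y) - r := by exact_mod_cast h1
  have h3 := hM (mem_image_of_mem _ hx)
  linarith

/-- A `c`-concave function is its own double transform. -/
theorem IsCConcave.eq_infTransform (hh : ConvexOn ℝ univ h) (hS : Bornology.IsBounded S)
    (hne : S.Nonempty) {ψ : Space d → ℝ} (hψ : IsCConcave S (diffCost h) ψ) {x : Space d}
    (hx : x ∈ S) : ψ x = infTransform h S (infTransform (reflect h) S ψ) x := by
  have hc := hh.locallyLipschitz.continuous
  have hb := hψ.bddAbove hc hS hne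
  refine le_antisymm (le_infTransform_infTransform hh hS hne hb hx) ?_
  obtain ⟨χ, hχ⟩ := hψ
  rw [← EReal.coe_le_coe_iff, hχ x hx]
  refine le_iInf₂ fun y hy => ?_
  have hle : ∀ x ∈ S, (ψ x : EReal) ≤ (h (x - y) : EReal) - χ y := fun x hx => by
    rw [hχ x hx]; exact iInf₂_le y hy
  simp only [diffCost]
  by_cases hyb : χ y = ⊥
  · rw [hyb]; simp
  have hyt : χ y ≠ ⊤ := by
    intro ht
    have h1 := hle x hx
    rw [ht] at h1
    simp at h1
  lift χ y to ℝ using ⟨hyt, hyb⟩ with r hr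
  -- The transform of `ψ` is the largest function compatible with `ψ`, so it dominates `χ`;
  -- transforming again reverses the inequality.
  have h1 : r ≤ infTransform (reflect h) S ψ y := by
    refine le_infTransform hne fun x' hx' => ?_
    have h2 : ψ x' ≤ h (x' - y) - r := by exact_mod_cast hle x' hx'
    rw [reflect_sub]
    linarith
  have h2 := infTransform_le hc hS (bddAbove_image_reflect_infTransform hh hS hne hb) x hy
  have h3 : infTransform h S (infTransform (reflect h) S ψ) x ≤ h (x - y) - r := by linarith
  exact_mod_cast h3

end Transform

/-! ### Contact points and the gradient map. -/

section Contact

variable {h : Space d → ℝ} {S : Set (Space d)} {f : Space d → ℝ}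

/-- The candidate optimal map `x ↦ x - ∇h*(∇u(x))` attached to a potential `u`. -/
def gradientMap (h u : Space d → ℝ) (x : Space d) : Space d :=
  x - ∇ (legendre h) (∇ u x)

theorem measurable_gradient (u : Space d → ℝ) : Measurable (∇ u) :=
  (InnerProductSpace.toDual ℝ (Space d)).symm.continuous.measurable.comp (measurable_fderiv ℝ u)

theorem measurable_gradientMap (h u : Space d → ℝ) : Measurable (gradientMap h u) :=
  measurable_id.sub ((measurable_gradient _).comp (measurable_gradient u))

/-- With the minimizer `y` kept fixed, the increments of the transform at `x` are bounded by those
of `h` at `x - y`. -/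
theorem isSubgradient_gradient_infTransform (hh : ConvexOn ℝ univ h)
    (hS : Bornology.IsBounded S) (hf : Continuous f) {x y : Space d} (hy : y ∈ closure S)
    (hxy : infTransform h S f x = h (x - y) - f y)
    (hd : DifferentiableAt ℝ (infTransform h S f) x) :
    IsSubgradient h (∇ (infTransform h S f) x) (x - y) := by
  refine isSubgradient_of_touching hh hd.hasGradientAt fun v => ?_
  have h1 := infTransform_le_of_mem_closure hh.locallyLipschitz.continuous hS hf (x + v) hy
  rw [add_sub_right_comm] at h1
  linarith

theorem eq_gradientMap_of_isSubgradient (hh : StrictConvexOn ℝ univ h) {u : Space d → ℝ}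
    {x y : Space d} (hp : IsSubgradient h (∇ u x) (x - y)) : gradientMap h u x = y := by
  rw [gradientMap, (hp.legendre hh).2.gradient]
  abel

/-- At a point of differentiability of the transform, the infimum is attained exactly at the image
of the point by the gradient map. -/
theorem infTransform_eq_gradientMap (hh : StrictConvexOn ℝ univ h)
    (hS : Bornology.IsBounded S) (hne : S.Nonempty) (hf : Continuous f) {x : Space d}
    (hd : DifferentiableAt ℝ (infTransform h S f) x) :
    gradientMap h (infTransform h S f) x ∈ closure S ∧
      infTransform h S f x = h (x - gradientMap h (infTransform h S f) x)
        - f (gradientMap h (infTransform h S f) x) ∧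
      IsSubgradient h (∇ (infTransform h S f) x)
        (x - gradientMap h (infTransform h S f) x) := by
  obtain ⟨y, hy, hxy⟩ :=
    exists_infTransform_eq hh.convexOn.locallyLipschitz.continuous hS hne hf x
  have hp := isSubgradient_gradient_infTransform hh.convexOn hS hf hy hxy hd
  rw [eq_gradientMap_of_isSubgradient hh hp]
  exact ⟨hy, hxy, hp⟩

/-- The boundary of `S` may have positive measure, so `ψ` can lack a full derivative on a non-null
part of `S`. At density points the derivative within `S` is unique, hence it is that of the
extension `u`. -/
theorem ae_hasGradientWithinAt {u ψ : Space d → ℝ} (hu : LocallyLipschitz u)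
    (hS : MeasurableSet S) (hψ : ∀ x ∈ S, ψ x = u x) :
    ∀ᵐ x ∂(volume.restrict S), DifferentiableAt ℝ u x ∧ DifferentiableWithinAt ℝ ψ S x ∧
      gradientWithin ψ S x = ∇ u x := by
  filter_upwards [ae_restrict_uniqueDiffWithinAt volume hS, ae_restrict_mem hS,
    ae_restrict_of_ae (ae_differentiableAt_of_locallyLipschitz volume hu)] with x hx hxS hxd
  have h1 : HasFDerivWithinAt ψ (fderiv ℝ u x) S x :=
    hxd.hasFDerivAt.hasFDerivWithinAt.congr hψ (hψ x hxS)
  refine ⟨hxd, h1.differentiableWithinAt, ?_⟩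
  rw [gradientWithin, h1.fderivWithin hx, gradient]

end Contact

/-! ### Duality gap and tightness. -/

section Duality

theorem integrable_of_continuous_of_bounded {X : Type*} [PseudoMetricSpace X] [ProperSpace X]
    [MeasurableSpace X] [OpensMeasurableSpace X] [SecondCountableTopology X] {μ : Measure X}
    [IsFiniteMeasure μ] {S : Set X} (hS : Bornology.IsBounded S) (hμ : μ Sᶜ = 0) {g : X → ℝ}
    (hg : Continuous g) : Integrable g μ := by
  obtain ⟨C, hC⟩ := (hS.isCompact_closure).exists_bound_of_continuousOn hg.continuousOn
  refine Integrable.of_bound hg.aestronglyMeasurable C ?_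
  filter_upwards [(show ∀ᵐ x ∂μ, x ∈ S from hμ)] with x hx
  exact hC x (subset_closure hx)

variable {h : Space d → ℝ} {S : Set (Space d)} {μ ν : Measure (Space d)}
  {γ : Measure (Space d × Space d)}

theorem measure_compl_closure_eq_zero (hν : ν Sᶜ = 0) : ν (closure S)ᶜ = 0 :=
  measure_mono_null (compl_subset_compl.2 subset_closure) hν

theorem IsTransportPlan.isProbabilityMeasure [IsProbabilityMeasure μ] (hγ : IsTransportPlan μ ν γ) :
    IsProbabilityMeasure γ := by
  have h1 : IsProbabilityMeasure (γ.map Prod.fst) := by rw [hγ.1]; infer_instance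
  exact (Measure.isProbabilityMeasure_map_iff measurable_fst.aemeasurable).1 h1

theorem IsTransportPlan.ae_fst (hγ : IsTransportPlan μ ν γ) {p : Space d → Prop}
    (hp : ∀ᵐ x ∂μ, p x) : ∀ᵐ z ∂γ, p z.1 := by
  rw [← hγ.1] at hp
  exact ae_of_ae_map measurable_fst.aemeasurable hp

theorem IsTransportPlan.ae_snd (hγ : IsTransportPlan μ ν γ) {p : Space d → Prop}
    (hp : ∀ᵐ x ∂ν, p x) : ∀ᵐ z ∂γ, p z.2 := by
  rw [← hγ.2] at hp
  exact ae_of_ae_map measurable_snd.aemeasurable hp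

theorem IsTransportPlan.measure_compl (hγ : IsTransportPlan μ ν γ) (hμ : μ Sᶜ = 0)
    (hν : ν (closure S)ᶜ = 0) : γ (closure S ×ˢ closure S)ᶜ = 0 := by
  have h1 := hγ.ae_fst (show ∀ᵐ x ∂μ, x ∈ S from hμ)
  have h2 := hγ.ae_snd (show ∀ᵐ x ∂ν, x ∈ closure S from hν)
  have h3 : ∀ᵐ z ∂γ, z ∈ closure S ×ˢ closure S := by
    filter_upwards [h1, h2] with z hz1 hz2 using ⟨subset_closure hz1, hz2⟩
  exact h3

theorem isTransportPlan_mapPlan {T : Space d → Space d} (hT : AEMeasurable T μ) :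
    IsTransportPlan μ (μ.map T) (mapPlan μ T) := by
  have hm : AEMeasurable (fun x => (x, T x)) μ := aemeasurable_id.prodMk hT
  constructor
  · rw [mapPlan, AEMeasurable.map_map_of_aemeasurable measurable_fst.aemeasurable hm]
    exact Measure.map_id
  · rw [mapPlan, AEMeasurable.map_map_of_aemeasurable measurable_snd.aemeasurable hm]
    rfl

variable [IsProbabilityMeasure μ]

/-- The cost of a plan, split into the dual value of a pair and the duality gap. -/
theorem IsTransportPlan.planCost_eq (hγ : IsTransportPlan μ ν γ) (hS : Bornology.IsBounded S)
    (hμ : μ Sᶜ = 0) (hν : ν (closure S)ᶜ = 0) (hh : Continuous h) (hh0 : ∀ z, 0 ≤ h z)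
    {u v : Space d → ℝ} (hu : Continuous u) (hv : Continuous v) :
    Integrable (fun z => h (z.1 - z.2) - u z.1 - v z.2) γ ∧
    planCost (diffCost h) γ = ENNReal.ofReal
      (∫ z, (h (z.1 - z.2) - u z.1 - v z.2) ∂γ + (∫ x, u x ∂μ + ∫ y, v y ∂ν)) := by
  have := hγ.isProbabilityMeasure
  have hbd : Bornology.IsBounded (closure S ×ˢ closure S) := hS.closure.prod hS.closure
  have hint : ∀ g : Space d × Space d → ℝ, Continuous g → Integrable g γ := fun g hg =>
    integrable_of_continuous_of_bounded hbd (hγ.measure_compl hμ hν) hg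
  refine ⟨hint _ (by fun_prop), ?_⟩
  have e1 : ∫ x, u x ∂μ = ∫ z, u z.1 ∂γ := by
    rw [← hγ.1, integral_map measurable_fst.aemeasurable hu.aestronglyMeasurable]
  have e2 : ∫ x, v x ∂ν = ∫ z, v z.2 ∂γ := by
    rw [← hγ.2, integral_map measurable_snd.aemeasurable hv.aestronglyMeasurable]
  have e3 : ∫ z, (h (z.1 - z.2) - u z.1 - v z.2) ∂γ + (∫ x, u x ∂μ + ∫ y, v y ∂ν)
      = ∫ z, h (z.1 - z.2) ∂γ := by
    rw [e1, e2, integral_sub (hint _ (by fun_prop)) (hint _ (by fun_prop)),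
      integral_sub (hint _ (by fun_prop)) (hint _ (by fun_prop))]
    ring
  rw [e3, planCost, ofReal_integral_eq_lintegral_ofReal (hint _ (by fun_prop))
    (Eventually.of_forall fun z => hh0 _)]
  rfl

/-- A map along which a dual admissible pair is tight is optimal. -/
theorem isOptimalMap_of_contact (hS : Bornology.IsBounded S) (hμ : μ Sᶜ = 0)
    (hh : Continuous h) (hh0 : ∀ z, 0 ≤ h z)
    {u v : Space d → ℝ} (hu : Continuous u) (hv : Continuous v)
    (huv : ∀ x ∈ S, ∀ y ∈ closure S, u x + v y ≤ h (x - y))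
    {T : Space d → Space d} (hT : AEMeasurable T μ) (hTS : ∀ᵐ x ∂μ, T x ∈ closure S)
    (hc : ∀ᵐ x ∂μ, u x + v (T x) = h (x - T x)) :
    IsOptimalMap (diffCost h) μ (μ.map T) T := by
  have := Measure.isProbabilityMeasure_map hT
  have hν : (μ.map T) (closure S)ᶜ = 0 :=
    (ae_map_iff hT isClosed_closure.measurableSet).2 hTS
  have hp := isTransportPlan_mapPlan hT
  refine ⟨hT, hp, fun γ hγ => ?_⟩
  rw [(hp.planCost_eq hS hμ hν hh hh0 hu hv).2, (hγ.planCost_eq hS hμ hν hh hh0 hu hv).2]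
  refine ENNReal.ofReal_le_ofReal (add_le_add_left ?_ _)
  have h0 : ∫ z, (h (z.1 - z.2) - u z.1 - v z.2) ∂(mapPlan μ T) = 0 := by
    refine integral_eq_zero_of_ae ((ae_map_iff (aemeasurable_id'.prodMk hT) ?_).2 ?_)
    · exact (isClosed_eq (by fun_prop) continuous_const).measurableSet
    · filter_upwards [hc] with x hx
      simp only [Pi.zero_apply]
      linarith
  rw [h0]
  refine integral_nonneg_of_ae ?_
  filter_upwards [hγ.ae_fst (show ∀ᵐ x ∂μ, x ∈ S from hμ),
    hγ.ae_snd (show ∀ᵐ x ∂(μ.map T), x ∈ closure S from hν)] with z hz1 hz2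
  have := huv _ hz1 _ hz2
  simp only [Pi.zero_apply]
  linarith

/-- A plan whose cost does not exceed the value of a dual pair is tight for this pair. -/
theorem IsTransportPlan.ae_contact (hγ : IsTransportPlan μ ν γ) (hS : Bornology.IsBounded S)
    (hμ : μ Sᶜ = 0) (hν : ν (closure S)ᶜ = 0) (hh : Continuous h) (hh0 : ∀ z, 0 ≤ h z)
    {u v : Space d → ℝ} (hu : Continuous u) (hv : Continuous v)
    (huv : ∀ x ∈ S, ∀ y ∈ closure S, u x + v y ≤ h (x - y))
    (hD : 0 ≤ ∫ x, u x ∂μ + ∫ y, v y ∂ν)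
    (hle : planCost (diffCost h) γ ≤ ENNReal.ofReal (∫ x, u x ∂μ + ∫ y, v y ∂ν)) :
    ∀ᵐ z ∂γ, u z.1 + v z.2 = h (z.1 - z.2) := by
  have := hγ.isProbabilityMeasure
  obtain ⟨hint, heq⟩ := hγ.planCost_eq hS hμ hν hh hh0 hu hv
  have hnn : 0 ≤ᵐ[γ] fun z => h (z.1 - z.2) - u z.1 - v z.2 := by
    filter_upwards [hγ.ae_fst (show ∀ᵐ x ∂μ, x ∈ S from hμ),
      hγ.ae_snd (show ∀ᵐ x ∂ν, x ∈ closure S from hν)] with z hz1 hz2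
    have := huv _ hz1 _ hz2
    simp only [Pi.zero_apply]
    linarith
  have hz : ∫ z, (h (z.1 - z.2) - u z.1 - v z.2) ∂γ = 0 := by
    -- `ENNReal.ofReal` truncates negative numbers, so real values can be compared only once the
    -- dual value is known to be nonnegative.
    rw [heq, ENNReal.ofReal_le_ofReal_iff hD] at hle
    exact le_antisymm (by linarith) (integral_nonneg_of_ae hnn)
  filter_upwards [(integral_eq_zero_iff_of_nonneg_ae hnn hint).1 hz] with z hz
  simp only [Pi.zero_apply] at hz
  linarith

/-- A plan that is tight for a dual pair has cost equal to the value of the pair. -/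
theorem IsTransportPlan.planCost_eq_of_contact (hγ : IsTransportPlan μ ν γ)
    (hS : Bornology.IsBounded S) (hμ : μ Sᶜ = 0) (hν : ν (closure S)ᶜ = 0) (hh : Continuous h)
    (hh0 : ∀ z, 0 ≤ h z) {u v : Space d → ℝ} (hu : Continuous u) (hv : Continuous v)
    (hc : ∀ᵐ z ∂γ, u z.1 + v z.2 = h (z.1 - z.2)) :
    0 ≤ ∫ x, u x ∂μ + ∫ y, v y ∂ν ∧
      planCost (diffCost h) γ = ENNReal.ofReal (∫ x, u x ∂μ + ∫ y, v y ∂ν) := by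
  have := hγ.isProbabilityMeasure
  have h0 : ∫ z, (h (z.1 - z.2) - u z.1 - v z.2) ∂γ = 0 := by
    refine integral_eq_zero_of_ae ?_
    filter_upwards [hc] with z hz
    simp only [Pi.zero_apply]
    linarith
  refine ⟨?_, by rw [(hγ.planCost_eq hS hμ hν hh hh0 hu hv).2, h0, zero_add]⟩
  have hint : ∀ g : Space d × Space d → ℝ, Continuous g → Integrable g γ := fun g hg =>
    integrable_of_continuous_of_bounded (hS.closure.prod hS.closure) (hγ.measure_compl hμ hν) hg
  rw [← hγ.1, ← hγ.2, integral_map measurable_fst.aemeasurable hu.aestronglyMeasurable,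
    integral_map measurable_snd.aemeasurable hv.aestronglyMeasurable,
    ← integral_add (hint _ (by fun_prop)) (hint _ (by fun_prop))]
  refine integral_nonneg_of_ae ?_
  filter_upwards [hc] with z hz
  simp only [Pi.zero_apply, hz]
  exact hh0 _

end Duality

/-! ### Existence of an optimal plan by weak compactness. -/

section Existence

/-- By monotone convergence the integral is the supremum of the integrals of the truncations at
height `n`, and each of these is weakly continuous. -/
theorem lowerSemicontinuous_lintegral_ofReal {X : Type*} [MeasurableSpace X] [TopologicalSpace X]
    [OpensMeasurableSpace X] {g : X → ℝ} (hg : Continuous g) :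
    LowerSemicontinuous fun γ : ProbabilityMeasure X =>
      ∫⁻ z, ENNReal.ofReal (g z) ∂(γ : Measure X) := by
  let F : ℕ → BoundedContinuousFunction X ℝ≥0 := fun n =>
    BoundedContinuousFunction.mkOfBound ⟨fun z => min (Real.toNNReal (g z)) n, by fun_prop⟩ n (by
      intro x y
      rw [NNReal.dist_eq, abs_le]
      have h1 : ((min (Real.toNNReal (g x)) n : ℝ≥0) : ℝ) ≤ n := by
        exact_mod_cast min_le_right (Real.toNNReal (g x)) (n : ℝ≥0)
      have h2 : ((min (Real.toNNReal (g y)) n : ℝ≥0) : ℝ) ≤ n := by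
        exact_mod_cast min_le_right (Real.toNNReal (g y)) (n : ℝ≥0)
      have h3 := (min (Real.toNNReal (g x)) n : ℝ≥0).2
      have h4 := (min (Real.toNNReal (g y)) n : ℝ≥0).2
      simp only [ContinuousMap.coe_mk]
      constructor <;> linarith)
  have hF : ∀ n z, F n z = min (Real.toNNReal (g z)) n := fun n z => rfl
  have hsup : (fun γ : ProbabilityMeasure X => ∫⁻ z, ENNReal.ofReal (g z) ∂(γ : Measure X)) =
      fun γ : ProbabilityMeasure X => ⨆ n, ∫⁻ z, F n z ∂(γ : Measure X) := by
    ext γ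
    rw [← lintegral_iSup]
    · refine lintegral_congr fun z => le_antisymm ?_ ?_
      · obtain ⟨n, hn⟩ := exists_nat_ge (Real.toNNReal (g z))
        refine le_iSup_of_le n ?_
        rw [hF, min_eq_left hn]
        rfl
      · refine iSup_le fun n => ?_
        rw [hF]
        exact ENNReal.coe_le_coe.2 (min_le_left _ _)
    · intro n
      exact (measurable_coe_nnreal_ennreal.comp (F n).continuous.measurable)
    · intro m n hmn z
      simp only [hF]
      exact ENNReal.coe_le_coe.2 (min_le_min_left _ (by exact_mod_cast hmn))
  rw [hsup]
  refine lowerSemicontinuous_iSup fun n => Continuous.lowerSemicontinuous ?_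
  rw [continuous_iff_continuousAt]
  intro γ
  exact ProbabilityMeasure.tendsto_iff_forall_lintegral_tendsto.1 tendsto_id (F n)

/-- Prokhorov: tight marginals make the plans tight, and the marginal constraints are closed since
pushforward by a continuous map is weakly continuous. -/
theorem isCompact_setOf_isTransportPlan (μ ν : Measure (Space d)) [IsProbabilityMeasure μ]
    [IsProbabilityMeasure ν] :
    IsCompact {γ : ProbabilityMeasure (Space d × Space d) | IsTransportPlan μ ν γ} := by
  set P := {γ : ProbabilityMeasure (Space d × Space d) | IsTransportPlan μ ν γ}
  have htight : IsTightMeasureSet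
      {((γ : ProbabilityMeasure (Space d × Space d)) : Measure (Space d × Space d)) | γ ∈ P} := by
    refine IsTightMeasureSet.prodMk ?_ ?_
    · refine (isTightMeasureSet_singleton (μ := μ)).subset ?_
      rintro _ ⟨_, ⟨γ, hγ, rfl⟩, rfl⟩
      exact hγ.1
    · refine (isTightMeasureSet_singleton (μ := ν)).subset ?_
      rintro _ ⟨_, ⟨γ, hγ, rfl⟩, rfl⟩
      exact hγ.2
  have hcl : IsClosed P := by
    let μ' : ProbabilityMeasure (Space d) := ⟨μ, inferInstance⟩
    let ν' : ProbabilityMeasure (Space d) := ⟨ν, inferInstance⟩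
    have e : P = (fun γ => γ.map continuous_fst.measurable.aemeasurable) ⁻¹' {μ'} ∩
        (fun γ => γ.map continuous_snd.measurable.aemeasurable) ⁻¹' {ν'} := by
      ext γ
      exact ⟨fun hγ => ⟨Subtype.ext hγ.1, Subtype.ext hγ.2⟩,
        fun hγ => ⟨congrArg Subtype.val hγ.1, congrArg Subtype.val hγ.2⟩⟩
    rw [e]
    exact (isClosed_singleton.preimage (ProbabilityMeasure.continuous_map continuous_fst)).inter
      (isClosed_singleton.preimage (ProbabilityMeasure.continuous_map continuous_snd))
  simpa [hcl.closure_eq] using isCompact_closure_of_isTightMeasureSet htight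

theorem exists_isOptimalPlan {c : Space d → Space d → ℝ}
    (hc : Continuous fun z : Space d × Space d => c z.1 z.2) (μ ν : Measure (Space d))
    [IsProbabilityMeasure μ] [IsProbabilityMeasure ν] : ∃ γ, IsOptimalPlan c μ ν γ := by
  have hne : {γ : ProbabilityMeasure (Space d × Space d) | IsTransportPlan μ ν γ}.Nonempty :=
    ⟨⟨μ.prod ν, inferInstance⟩, show IsTransportPlan μ ν (μ.prod ν) by
      simp [IsTransportPlan]⟩
  obtain ⟨γ, hγ, hmin⟩ := LowerSemicontinuousOn.exists_isMinOn hne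
    (isCompact_setOf_isTransportPlan μ ν)
    ((lowerSemicontinuous_lintegral_ofReal hc).lowerSemicontinuousOn _)
  refine ⟨γ, hγ, fun γ' hγ' => ?_⟩
  have := hγ'.isProbabilityMeasure
  exact hmin (show (⟨γ', this⟩ : ProbabilityMeasure (Space d × Space d)) ∈ _ from hγ')

end Existence

/-! ### Existence of Kantorovich potentials. -/

section Potentials

/-- The double transform of `ψ`, a locally Lipschitz extension of `ψ` to the whole space if `ψ` is
`c`-concave on `S`. -/
def biTransform (h : Space d → ℝ) (S : Set (Space d)) (ψ : Space d → ℝ) : Space d → ℝ :=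
  infTransform h S (infTransform (reflect h) S ψ)

variable {h : Space d → ℝ} {S : Set (Space d)} {μ ν : Measure (Space d)}
  {ψ : Space d → ℝ}

theorem infTransform_add_const (hh : Continuous h) (hS : Bornology.IsBounded S)
    (hne : S.Nonempty) {f : Space d → ℝ} (hf : BddAbove (f '' S)) (a : ℝ) (x : Space d) :
    infTransform h S (fun y => f y + a) x = infTransform h S f x - a := by
  have hfa : BddAbove ((fun y => f y + a) '' S) := by
    obtain ⟨M, hM⟩ := hf
    refine ⟨M + a, ?_⟩
    rintro _ ⟨y, hy, rfl⟩
    have := hM (mem_image_of_mem _ hy)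
    simpa using this
  refine le_antisymm ?_ ?_
  · simpa [sub_eq_add_neg] using infTransform_le_add hh hS hne hfa (g := f) (a := -a) (by simp) x
  · have := infTransform_le_add hh hS hne hf (g := fun y => f y + a) (a := a) (by simp) x
    linarith

theorem continuous_conj (hh : ConvexOn ℝ univ h) (hS : Bornology.IsBounded S) (hne : S.Nonempty)
    (hψ : BddAbove (ψ '' S)) : Continuous (infTransform (reflect h) S ψ) :=
  continuous_infTransform (convexOn_reflect hh) hS hne hψ

theorem locallyLipschitz_biTransform (hh : ConvexOn ℝ univ h) (hS : Bornology.IsBounded S)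
    (hne : S.Nonempty) (hψ : BddAbove (ψ '' S)) : LocallyLipschitz (biTransform h S ψ) :=
  locallyLipschitz_infTransform hh hS hne (bddAbove_image_reflect_infTransform hh hS hne hψ)

theorem biTransform_add_conj_le (hh : ConvexOn ℝ univ h) (hS : Bornology.IsBounded S)
    (hne : S.Nonempty) (hψ : BddAbove (ψ '' S)) (x : Space d) {y : Space d}
    (hy : y ∈ closure S) :
    biTransform h S ψ x + infTransform (reflect h) S ψ y ≤ h (x - y) := by
  have := infTransform_le_of_mem_closure hh.locallyLipschitz.continuous hS
    (continuous_conj hh hS hne hψ) x hy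
  rw [biTransform]
  linarith

theorem IsCConcave.dualValue_eq (hψ : IsCConcave S (diffCost h) ψ) (hh : ConvexOn ℝ univ h)
    (hS : Bornology.IsBounded S) (hne : S.Nonempty) (hμ : μ Sᶜ = 0) :
    dualValue S (diffCost h) μ ν ψ
      = ∫ x, biTransform h S ψ x ∂μ + ∫ y, infTransform (reflect h) S ψ y ∂ν := by
  have hb := hψ.bddAbove hh.locallyLipschitz.continuous hS hne
  rw [dualValue]
  simp_rw [cConj_eq hh hS hne hb, EReal.toReal_coe]
  congr 1
  refine integral_congr_ae ?_
  filter_upwards [(show ∀ᵐ x ∂μ, x ∈ S from hμ)] with x hx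
  exact hψ.eq_infTransform hh hS hne hx

/-- On a bounded set `ψ` and `ψ^c` agree with continuous functions, so integrability is automatic.
-/
theorem IsCConcave.isDualAdmissible [IsProbabilityMeasure μ] [IsProbabilityMeasure ν]
    (hψ : IsCConcave S (diffCost h) ψ) (hh : ConvexOn ℝ univ h)
    (hS : Bornology.IsBounded S) (hne : S.Nonempty) (hμ : μ Sᶜ = 0) (hν : ν Sᶜ = 0) :
    IsDualAdmissible S (diffCost h) μ ν ψ := by
  have hb := hψ.bddAbove hh.locallyLipschitz.continuous hS hne
  refine ⟨hψ, ?_, ?_, ?_⟩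
  · refine (integrable_of_continuous_of_bounded hS hμ
      (locallyLipschitz_biTransform hh hS hne hb).continuous).congr ?_
    filter_upwards [(show ∀ᵐ x ∂μ, x ∈ S from hμ)] with x hx
    exact (hψ.eq_infTransform hh hS hne hx).symm
  · refine Eventually.of_forall fun y => ?_
    rw [cConj_eq hh hS hne hb]
    simp
  · simp_rw [cConj_eq hh hS hne hb, EReal.toReal_coe]
    exact integrable_of_continuous_of_bounded hS hν (continuous_conj hh hS hne hb)

/-- Replacing a pair `(f^c, f)` by `(f^c, f^{cc})` does not decrease the dual functional. -/
theorem le_dualValue_infTransform [IsProbabilityMeasure ν] (hh : ConvexOn ℝ univ h) (hS : Bornology.IsBounded S)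
    (hne : S.Nonempty) (hν : ν Sᶜ = 0) {f : Space d → ℝ} (hf : Continuous f) :
    ∫ x, infTransform h S f x ∂μ + ∫ y, f y ∂ν
      ≤ dualValue S (diffCost h) μ ν (infTransform h S f) := by
  have hfb := bddAbove_image_of_continuous hS hf
  have hu := continuous_infTransform hh hS hne hfb
  have hb := bddAbove_image_of_continuous hS hu
  rw [dualValue]
  simp_rw [cConj_eq hh hS hne hb, EReal.toReal_coe]
  refine add_le_add_right (integral_mono_ae (integrable_of_continuous_of_bounded hS hν hf)
    (integrable_of_continuous_of_bounded hS hν (continuous_conj hh hS hne hb)) ?_) _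
  filter_upwards [(show ∀ᵐ x ∂ν, x ∈ S from hν)] with y hy
  refine le_infTransform hne fun x _ => ?_
  have := infTransform_le hh.locallyLipschitz.continuous hS hfb x hy
  rw [reflect_sub]
  linarith

theorem isCompact_closure_setOf_lipschitzWith {X : Type*} [PseudoMetricSpace X] [CompactSpace X]
    (k₀ : X) (L : ℝ≥0) :
    IsCompact (closure {g : BoundedContinuousFunction X ℝ | g k₀ = 0 ∧ LipschitzWith L g}) := by
  refine BoundedContinuousFunction.arzela_ascoli (closedBall 0 (L * diam (univ : Set X)))
    (isCompact_closedBall _ _) _ ?_ ?_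
  · rintro g x ⟨hg0, hg⟩
    rw [mem_closedBall, ← hg0]
    refine (hg.dist_le_mul x k₀).trans ?_
    gcongr
    exact dist_le_diam_of_mem isCompact_univ.isBounded (mem_univ _) (mem_univ _)
  · exact (LipschitzWith.uniformEquicontinuous _ L fun g => g.2.2).equicontinuous

/-- Existence of a maximizer of the dual functional, by the Arzelà–Ascoli theorem. -/
theorem exists_isKantorovichPotential [IsProbabilityMeasure μ] [IsProbabilityMeasure ν]
    (hh : ConvexOn ℝ univ h) (hS : Bornology.IsBounded S)
    (hne : S.Nonempty) (hμ : μ Sᶜ = 0) (hν : ν Sᶜ = 0) :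
    ∃ ψ, IsKantorovichPotential S (diffCost h) μ ν ψ := by
  classical
  have hc := hh.locallyLipschitz.continuous
  have hc' := (convexOn_reflect hh).locallyLipschitz.continuous
  obtain ⟨x₀, hx₀⟩ := hne
  have hne : S.Nonempty := ⟨x₀, hx₀⟩
  obtain ⟨R, hR⟩ := hS.closure.subset_closedBall (0 : Space d)
  obtain ⟨L, hL⟩ := exists_lipschitzOnWith_infTransform hh hS hne R
  have : CompactSpace (closure S) := isCompact_iff_compactSpace.1 hS.isCompact_closure
  let k₀ : closure S := ⟨x₀, subset_closure hx₀⟩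
  let A : Set (BoundedContinuousFunction (closure S) ℝ) := {g | g k₀ = 0 ∧ LipschitzWith L g}
  have hA : IsCompact (closure A) := isCompact_closure_setOf_lipschitzWith k₀ L
  let e : BoundedContinuousFunction (closure S) ℝ → Space d → ℝ := fun g x =>
    if hx : x ∈ closure S then g ⟨x, hx⟩ else 0
  have he : ∀ g, ∀ x (hx : x ∈ S), e g x = g ⟨x, subset_closure hx⟩ := fun g x hx => by
    simp [e, subset_closure hx]
  have heb : ∀ g, BddAbove (e g '' S) := by
    intro g
    refine ⟨‖g‖, ?_⟩
    rintro _ ⟨x, hx, rfl⟩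
    rw [he g x hx]
    exact (le_abs_self _).trans (g.norm_coe_le_norm _)
  -- Double transforms make `J` meaningful for every bounded continuous `g`. It is 2-Lipschitz
  -- because each of the two transforms is nonexpansive for the uniform distance.
  let J : BoundedContinuousFunction (closure S) ℝ → ℝ := fun g =>
    ∫ x, biTransform h S (e g) x ∂μ + ∫ y, infTransform (reflect h) S (e g) y ∂ν
  have hφ : ∀ g, Integrable (infTransform (reflect h) S (e g)) ν := fun g =>
    integrable_of_continuous_of_bounded hS hν (continuous_conj hh hS hne (heb g))
  have hψ : ∀ g, Integrable (biTransform h S (e g)) μ := fun g =>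
    integrable_of_continuous_of_bounded hS hμ
      (locallyLipschitz_biTransform hh hS hne (heb g)).continuous
  have hJ : LipschitzWith 2 J := by
    refine LipschitzWith.of_le_add_mul 2 fun g g' => ?_
    have key : ∀ g g' : BoundedContinuousFunction (closure S) ℝ, ∀ y,
        infTransform (reflect h) S (e g) y ≤ infTransform (reflect h) S (e g') y + dist g g' := by
      intro g g' y
      refine infTransform_le_add hc' hS hne (heb g) (fun x hx => ?_) y
      rw [he g x hx, he g' x hx]
      have h1 := (abs_le.1 (g.dist_coe_le_dist (g := g') ⟨x, subset_closure hx⟩)).1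
      linarith
    have h1 : ∫ y, infTransform (reflect h) S (e g) y ∂ν ≤
        ∫ y, infTransform (reflect h) S (e g') y ∂ν + dist g g' := by
      have := integral_mono (hφ g) ((hφ g').add (integrable_const (dist g g')))
        fun y => key g g' y
      rwa [integral_add' (hφ g') (integrable_const _), integral_const, probReal_univ,
        one_smul] at this
    have h2 : ∫ x, biTransform h S (e g) x ∂μ ≤ ∫ x, biTransform h S (e g') x ∂μ + dist g g' := by
      have := integral_mono (hψ g) ((hψ g').add (integrable_const (dist g g'))) fun y => by
        refine infTransform_le_add hc hS hne
          (bddAbove_image_reflect_infTransform hh hS hne (heb g)) (fun x _ => ?_) y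
        rw [dist_comm]
        exact key g' g x
      rwa [integral_add' (hψ g') (integrable_const _), integral_const, probReal_univ,
        one_smul] at this
    simp only [J, NNReal.coe_ofNat]
    linarith
  have hL' : ∀ ψ : Space d → ℝ, BddAbove (ψ '' S) →
      LipschitzOnWith L (biTransform h S ψ) (closedBall 0 R) := fun ψ hb =>
    hL _ (bddAbove_image_reflect_infTransform hh hS hne hb)
  -- Subtracting the value at `x₀` normalizes `φ`. The two integrals shift by opposite constants,
  -- since `μ` and `ν` have equal mass.
  have hcov : ∀ φ, IsCConcave S (diffCost h) φ →
      ∃ g ∈ A, J g = dualValue S (diffCost h) μ ν φ := by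
    intro φ hφc
    have hb := hφc.bddAbove hc hS hne
    set a := biTransform h S φ x₀ with ha
    have hl := locallyLipschitz_biTransform hh hS hne hb
    let g : BoundedContinuousFunction (closure S) ℝ := BoundedContinuousFunction.mkOfCompact
      ⟨fun x => biTransform h S φ x - a, by
        have := hl.continuous
        fun_prop⟩
    have hg : ∀ x, g x = biTransform h S φ x - a := fun x => rfl
    refine ⟨g, ⟨by simp [hg, k₀, ha], ?_⟩, ?_⟩
    · refine LipschitzWith.of_dist_le_mul fun x y => ?_
      rw [hg, hg, dist_sub_right]
      exact (hL' φ hb).dist_le_mul _ (hR x.2) _ (hR y.2)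
    · have e1 : ∀ y, infTransform (reflect h) S (e g) y
          = infTransform (reflect h) S φ y + a := by
        intro y
        rw [infTransform_congr (g := fun x => φ x + -a), infTransform_add_const hc' hS hne hb]
        · ring
        · intro x hx
          rw [he g x hx, hg, hφc.eq_infTransform hh hS hne hx]
          rfl
      have e2 : ∀ x, biTransform h S (e g) x = biTransform h S φ x - a := by
        intro x
        rw [biTransform, funext e1, infTransform_add_const hc hS hne
          (bddAbove_image_reflect_infTransform hh hS hne hb)]
        rfl
      simp only [J, e1, e2]
      rw [hφc.dualValue_eq hh hS hne hμ, integral_add, integral_sub, integral_const,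
        integral_const, probReal_univ, probReal_univ]
      · ring
      · exact integrable_of_continuous_of_bounded hS hμ hl.continuous
      · exact integrable_const _
      · exact integrable_of_continuous_of_bounded hS hν (continuous_conj hh hS hne hb)
      · exact integrable_const _
  obtain ⟨g₀, hg₀⟩ : A.Nonempty := ⟨0, rfl, LipschitzWith.const' _⟩
  obtain ⟨g, -, hgmax⟩ := hA.exists_isMaxOn ⟨g₀, subset_closure hg₀⟩ hJ.continuous.continuousOn
  -- The maximizer `g` itself need not be `c`-concave; its double transform is, and its dual value
  -- is at least `J g`.
  refine ⟨biTransform h S (e g), (isCConcave_infTransform hc hS hne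
    (bddAbove_image_reflect_infTransform hh hS hne (heb g))).isDualAdmissible hh hS hne hμ hν,
    fun φ hφa => ?_⟩
  obtain ⟨g', hg', hJg'⟩ := hcov φ hφa.1
  rw [← hJg']
  exact (hgmax (subset_closure hg')).trans
    (le_dualValue_infTransform hh hS hne hν (continuous_conj hh hS hne (heb g)))

end Potentials

/-! ### First variation of the dual functional. -/

section FirstVariation

variable {h : Space d → ℝ} {S : Set (Space d)} {μ ν : Measure (Space d)} {ψ : Space d → ℝ}

/-- The derivative of `ε ↦ inf_{y ∈ S} h (x - y) - φ y - ε g y` at `ε = 0`, at a point `x` where the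
unperturbed transform is differentiable. -/
theorem tendsto_infTransform_perturbation (hh : StrictConvexOn ℝ univ h)
    (hS : Bornology.IsBounded S) (hne : S.Nonempty) {φ : Space d → ℝ} (hφ : Continuous φ)
    (g : BoundedContinuousFunction (Space d) ℝ) {x : Space d}
    (hd : DifferentiableAt ℝ (infTransform h S φ) x) {ε : ℕ → ℝ} (hε : ∀ n, 0 < ε n)
    (hε0 : Tendsto ε atTop (𝓝 0)) :
    Tendsto (fun n => (infTransform h S φ x - infTransform h S (fun y => φ y + ε n * g y) x) / ε n)
      atTop (𝓝 (g (gradientMap h (infTransform h S φ) x))) := by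
  have hc := hh.convexOn.locallyLipschitz.continuous
  set T := gradientMap h (infTransform h S φ) x with hT
  obtain ⟨hTS, hTx, -⟩ := infTransform_eq_gradientMap hh hS hne hφ hd
  have hpc : ∀ n, Continuous fun y => φ y + ε n * g y := fun n => by fun_prop
  choose y hyS hy using fun n => exists_infTransform_eq hc hS hne (hpc n) x
  have hup : ∀ n, infTransform h S (fun y => φ y + ε n * g y) x
      ≤ infTransform h S φ x - ε n * g T := fun n => by
    have := infTransform_le_of_mem_closure hc hS (hpc n) x hTS
    rw [hTx]
    linarith
  have hG : ∀ n, infTransform h S φ x ≤ h (x - y n) - φ (y n) := fun n =>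
    infTransform_le_of_mem_closure hc hS hφ x (hyS n)
  -- Minimizers of the perturbed problems form a minimizing sequence for the unperturbed one, up to
  -- an error `ε n * (2 * ‖g‖)`.
  have hlim : Tendsto (fun n => h (x - y n) - φ (y n)) atTop (𝓝 (infTransform h S φ x)) := by
    have h1 : Tendsto (fun n => infTransform h S φ x + ε n * (2 * ‖g‖)) atTop
        (𝓝 (infTransform h S φ x)) := by
      simpa using (hε0.mul_const (2 * ‖g‖)).const_add (infTransform h S φ x)
    refine tendsto_of_tendsto_of_tendsto_of_le_of_le tendsto_const_nhds h1 hG fun n => ?_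
    have h2 := hup n
    rw [hy n] at h2
    have h3 := (abs_le.1 (g.norm_coe_le_norm T)).1
    have h4 := (abs_le.1 (g.norm_coe_le_norm (y n))).2
    have h5 : ε n * (g (y n) - g T) ≤ ε n * (2 * ‖g‖) :=
      mul_le_mul_of_nonneg_left (by linarith) (hε n).le
    simp only at h2 ⊢
    linarith
  -- By compactness it suffices to identify cluster points. Each is an unperturbed minimizer, and
  -- differentiability at `x` leaves only `T`.
  have hyT : Tendsto y atTop (𝓝 T) := by
    refine hS.isCompact_closure.tendsto_nhds_of_unique_mapClusterPt
      (Eventually.of_forall hyS) fun z hz hcl => ?_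
    have h1 : MapClusterPt (h (x - z) - φ z) atTop (fun n => h (x - y n) - φ (y n)) :=
      hcl.continuousAt_comp (f := fun w => h (x - w) - φ w)
        (Continuous.continuousAt (by fun_prop))
    have h2 : h (x - z) - φ z = infTransform h S φ x := by
      refine eq_of_nhds_neBot (h1.neBot.mono ?_)
      exact inf_le_inf_left _ hlim
    exact (eq_gradientMap_of_isSubgradient hh
      (isSubgradient_gradient_infTransform hh.convexOn hS hφ hz h2.symm hd)).symm
  -- Using `T` in the perturbed problem and `y n` in the unperturbed one traps the quotient between
  -- `g T` and `g (y n)`.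
  refine tendsto_of_tendsto_of_tendsto_of_le_of_le tendsto_const_nhds
    ((g.continuous.tendsto T).comp hyT) (fun n => ?_) fun n => ?_
  · rw [le_div_iff₀ (hε n)]
    have := hup n
    linarith
  · rw [div_le_iff₀ (hε n), hy n]
    have := hG n
    simp only [Function.comp_apply]
    linarith

/-- The gradient map of a Kantorovich potential transports `μ` to `ν`. -/
theorem IsKantorovichPotential.map_gradientMap [IsProbabilityMeasure μ] [IsProbabilityMeasure ν]
    (hψ : IsKantorovichPotential S (diffCost h) μ ν ψ) (hh : StrictConvexOn ℝ univ h)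
    (hS : Bornology.IsBounded S) (hne : S.Nonempty) (hμ : μ Sᶜ = 0) (hν : ν Sᶜ = 0)
    (hac : μ ≪ volume) : μ.map (gradientMap h (biTransform h S ψ)) = ν := by
  have hconv := hh.convexOn
  have hc := hconv.locallyLipschitz.continuous
  have hb := hψ.1.1.bddAbove hc hS hne
  have hl := locallyLipschitz_biTransform hconv hS hne hb
  set u := biTransform h S ψ with hu
  set φ := infTransform (reflect h) S ψ with hφ
  have hφc : Continuous φ := continuous_conj hconv hS hne hb
  have hTm := measurable_gradientMap h u
  have hae : ∀ᵐ x ∂μ, DifferentiableAt ℝ u x :=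
    hac.ae_le (ae_differentiableAt_of_locallyLipschitz volume hl)
  -- One inequality for all `g` is enough: `-g` supplies the reverse one.
  have hle : ∀ g : BoundedContinuousFunction (Space d) ℝ,
      ∫ y, g y ∂ν ≤ ∫ x, g (gradientMap h u x) ∂μ := by
    intro g
    let ε : ℕ → ℝ := fun n => 1 / ((n : ℝ) + 1)
    have hε : ∀ n, 0 < ε n := fun n => by positivity
    have hε0 : Tendsto ε atTop (𝓝 0) := tendsto_one_div_add_atTop_nhds_zero_nat
    let w : ℕ → Space d → ℝ := fun n => infTransform h S (fun y => φ y + ε n * g y)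
    have hpc : ∀ n, Continuous fun y => φ y + ε n * g y := fun n => by fun_prop
    have hwc : ∀ n, Continuous (w n) := fun n =>
      continuous_infTransform hconv hS hne (bddAbove_image_of_continuous hS (hpc n))
    have hui : Integrable u μ := integrable_of_continuous_of_bounded hS hμ hl.continuous
    have hwi : ∀ n, Integrable (w n) μ := fun n =>
      integrable_of_continuous_of_bounded hS hμ (hwc n)
    have hφi : Integrable φ ν := integrable_of_continuous_of_bounded hS hν hφc
    have hgi : Integrable g ν := g.integrable ν
    -- The pair `(w n, φ + ε n * g)` has dual value at most that of the `c`-concave `w n`, hence at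
    -- most the maximum.
    have hn : ∀ n, ∫ y, g y ∂ν ≤ ∫ x, (u x - w n x) / ε n ∂μ := by
      intro n
      have h1 := le_dualValue_infTransform (μ := μ) hconv hS hne hν (hpc n)
      have h2 := hψ.2 (w n) ((isCConcave_infTransform hc hS hne
        (bddAbove_image_of_continuous hS (hpc n))).isDualAdmissible hconv hS hne hμ hν)
      rw [hψ.1.1.dualValue_eq hconv hS hne hμ] at h2
      have h3 : ∫ y, (φ y + ε n * g y) ∂ν = ∫ y, φ y ∂ν + ε n * ∫ y, g y ∂ν := by
        rw [integral_add hφi (hgi.const_mul _), integral_const_mul]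
      rw [h3] at h1
      have h4 := h1.trans h2
      rw [integral_div, le_div_iff₀ (hε n), integral_sub hui (hwi n)]
      linarith
    have hlim : Tendsto (fun n => ∫ x, (u x - w n x) / ε n ∂μ) atTop
        (𝓝 (∫ x, g (gradientMap h u x) ∂μ)) := by
      refine tendsto_integral_of_dominated_convergence (fun _ => ‖g‖) (fun n => ?_)
        (integrable_const _) (fun n => Eventually.of_forall fun x => ?_) ?_
      · exact (Continuous.div_const (hl.continuous.sub (hwc n)) _).aestronglyMeasurable
      · have hg : ∀ y, |ε n * g y| ≤ ε n * ‖g‖ := fun y => by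
          rw [abs_mul, abs_of_pos (hε n)]
          exact mul_le_mul_of_nonneg_left (g.norm_coe_le_norm y) (hε n).le
        have h1 : u x ≤ w n x + ε n * ‖g‖ :=
          infTransform_le_add hc hS hne (bddAbove_image_of_continuous hS hφc)
            (fun y _ => by linarith [(abs_le.1 (hg y)).2]) x
        have h2 : w n x ≤ u x + ε n * ‖g‖ :=
          infTransform_le_add hc hS hne (bddAbove_image_of_continuous hS (hpc n))
            (fun y _ => by linarith [(abs_le.1 (hg y)).1]) x
        rw [norm_div, Real.norm_of_nonneg (hε n).le, div_le_iff₀ (hε n), Real.norm_eq_abs, abs_le]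
        constructor <;> linarith
      · filter_upwards [hae] with x hx
        exact tendsto_infTransform_perturbation hh hS hne hφc g hx hε hε0
    exact ge_of_tendsto' hlim hn
  have := Measure.isProbabilityMeasure_map (μ := μ) hTm.aemeasurable
  refine ext_of_forall_integral_eq_of_IsFiniteMeasure fun g => ?_
  rw [integral_map hTm.aemeasurable g.continuous.aestronglyMeasurable]
  refine le_antisymm ?_ (hle g)
  have := hle (-g)
  simp only [BoundedContinuousFunction.coe_neg, Pi.neg_apply, integral_neg] at this
  linarith

end FirstVariation

/-! ### Optimality of the gradient map and uniqueness of the plan. -/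

section Optimality

variable {h : Space d → ℝ} {S : Set (Space d)} {μ ν : Measure (Space d)} {ψ : Space d → ℝ}

theorem ae_eq_of_mapPlan_eq {T T' : Space d → Space d} (hT : Measurable T)
    (hT' : AEMeasurable T' μ) (heq : mapPlan μ T' = mapPlan μ T) : T' =ᵐ[μ] T := by
  have hms : MeasurableSet {z : Space d × Space d | z.2 = T z.1} :=
    measurableSet_eq_fun measurable_snd (hT.comp measurable_fst)
  have h1 : ∀ᵐ z ∂(mapPlan μ T), z.2 = T z.1 :=
    (ae_map_iff (aemeasurable_id'.prodMk hT.aemeasurable) hms).2 (Eventually.of_forall fun _ => rfl)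
  rw [← heq] at h1
  exact (ae_map_iff (aemeasurable_id'.prodMk hT') hms).1 h1

/-- A plan carried by the graph of a map is induced by this map. -/
theorem IsTransportPlan.eq_mapPlan {γ : Measure (Space d × Space d)} (hγ : IsTransportPlan μ ν γ)
    {T : Space d → Space d} (hT : Measurable T) (hgraph : ∀ᵐ z ∂γ, z.2 = T z.1) :
    γ = mapPlan μ T := by
  have hm : Measurable fun x => (x, T x) := measurable_id.prodMk hT
  calc γ = γ.map id := Measure.map_id.symm
    _ = γ.map ((fun x => (x, T x)) ∘ Prod.fst) := by
        refine Measure.map_congr ?_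
        filter_upwards [hgraph] with z hz
        exact Prod.ext rfl hz
    _ = mapPlan μ T := by rw [← Measure.map_map hm measurable_fst, hγ.1, mapPlan]

theorem IsCConcave.ae_gradientWithin (hψ : IsCConcave S (diffCost h) ψ) (hh : ConvexOn ℝ univ h)
    (hSm : MeasurableSet S) (hS : Bornology.IsBounded S) (hne : S.Nonempty) (hμ : μ Sᶜ = 0)
    (hac : μ ≪ volume) :
    ∀ᵐ x ∂μ, x ∈ S ∧ DifferentiableAt ℝ (biTransform h S ψ) x ∧
      DifferentiableWithinAt ℝ ψ S x ∧ gradientWithin ψ S x = ∇ (biTransform h S ψ) x := by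
  have hb := hψ.bddAbove hh.locallyLipschitz.continuous hS hne
  have h1 := (ae_restrict_iff' hSm).1 (ae_hasGradientWithinAt
    (locallyLipschitz_biTransform hh hS hne hb) hSm
    fun x hx => hψ.eq_infTransform hh hS hne hx)
  filter_upwards [hac.ae_le h1, (show ∀ᵐ x ∂μ, x ∈ S from hμ)] with x hx hxS
  exact ⟨hxS, hx hxS⟩

/-- Contact at points of differentiability, in terms of the double transform. -/
theorem IsCConcave.contact (hψ : IsCConcave S (diffCost h) ψ) (hh : StrictConvexOn ℝ univ h)
    (hS : Bornology.IsBounded S) (hne : S.Nonempty) {x : Space d}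
    (hd : DifferentiableAt ℝ (biTransform h S ψ) x) :
    gradientMap h (biTransform h S ψ) x ∈ closure S ∧
      biTransform h S ψ x + infTransform (reflect h) S ψ (gradientMap h (biTransform h S ψ) x)
        = h (x - gradientMap h (biTransform h S ψ) x) ∧
      IsSubgradient h (∇ (biTransform h S ψ) x) (x - gradientMap h (biTransform h S ψ) x) := by
  have hb := hψ.bddAbove hh.convexOn.locallyLipschitz.continuous hS hne
  obtain ⟨h1, h2, h3⟩ :=
    infTransform_eq_gradientMap hh hS hne (continuous_conj hh.convexOn hS hne hb) hd
  refine ⟨h1, ?_, h3⟩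
  have h2' : biTransform h S ψ x = h (x - gradientMap h (biTransform h S ψ) x)
    - infTransform (reflect h) S ψ (gradientMap h (biTransform h S ψ) x) := h2
  linarith

/-- The gradient map of a `c`-concave function is optimal onto its image. -/
theorem IsCConcave.isOptimalMap [IsProbabilityMeasure μ] (hψ : IsCConcave S (diffCost h) ψ)
    (hh : StrictConvexOn ℝ univ h) (hh0 : ∀ z, 0 ≤ h z) (hS : Bornology.IsBounded S)
    (hne : S.Nonempty) (hμ : μ Sᶜ = 0)
    (hd : ∀ᵐ x ∂μ, DifferentiableAt ℝ (biTransform h S ψ) x) {T : Space d → Space d}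
    (hT : T =ᵐ[μ] gradientMap h (biTransform h S ψ)) :
    IsOptimalMap (diffCost h) μ (μ.map T) T := by
  have hc := hh.convexOn.locallyLipschitz.continuous
  have hb := hψ.bddAbove hc hS hne
  refine isOptimalMap_of_contact hS hμ hc hh0
    (locallyLipschitz_biTransform hh.convexOn hS hne hb).continuous
    (continuous_conj hh.convexOn hS hne hb)
    (fun x _ y hy => biTransform_add_conj_le hh.convexOn hS hne hb x hy)
    ⟨_, measurable_gradientMap h _, hT⟩ ?_ ?_
  · filter_upwards [hd, hT] with x hx hTx
    rw [hTx]
    exact (hψ.contact hh hS hne hx).1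
  · filter_upwards [hd, hT] with x hx hTx
    rw [hTx]
    exact (hψ.contact hh hS hne hx).2.1

section Potential

variable [IsProbabilityMeasure μ] [IsProbabilityMeasure ν]

/-- Contact makes the gradient map optimal onto its image, and the first variation identifies that
image with `ν`. -/
theorem IsKantorovichPotential.isOptimalMap
    (hψ : IsKantorovichPotential S (diffCost h) μ ν ψ) (hh : StrictConvexOn ℝ univ h)
    (hh0 : ∀ z, 0 ≤ h z) (hS : Bornology.IsBounded S) (hne : S.Nonempty) (hμ : μ Sᶜ = 0)
    (hν : ν Sᶜ = 0) (hac : μ ≪ volume) :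
    IsOptimalMap (diffCost h) μ ν (gradientMap h (biTransform h S ψ)) := by
  have hb := hψ.1.1.bddAbove hh.convexOn.locallyLipschitz.continuous hS hne
  have h1 := hψ.1.1.isOptimalMap (T := gradientMap h (biTransform h S ψ)) hh hh0 hS hne hμ
    (hac.ae_le (ae_differentiableAt_of_locallyLipschitz volume
      (locallyLipschitz_biTransform hh.convexOn hS hne hb))) (ae_eq_refl _)
  rwa [hψ.map_gradientMap hh hS hne hμ hν hac] at h1

/-- Every optimal plan is induced by the gradient map of every Kantorovich potential. -/
theorem IsKantorovichPotential.eq_mapPlan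
    (hψ : IsKantorovichPotential S (diffCost h) μ ν ψ) (hh : StrictConvexOn ℝ univ h)
    (hh0 : ∀ z, 0 ≤ h z) (hS : Bornology.IsBounded S) (hne : S.Nonempty) (hμ : μ Sᶜ = 0)
    (hν : ν Sᶜ = 0) (hac : μ ≪ volume) {γ : Measure (Space d × Space d)}
    (hγ : IsOptimalPlan (diffCost h) μ ν γ) :
    γ = mapPlan μ (gradientMap h (biTransform h S ψ)) := by
  have hconv := hh.convexOn
  have hc := hconv.locallyLipschitz.continuous
  have hb := hψ.1.1.bddAbove hc hS hne
  have hl := locallyLipschitz_biTransform hconv hS hne hb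
  have hφ := continuous_conj hconv hS hne hb
  have hν' := measure_compl_closure_eq_zero hν
  have hd : ∀ᵐ x ∂μ, DifferentiableAt ℝ (biTransform h S ψ) x :=
    hac.ae_le (ae_differentiableAt_of_locallyLipschitz volume hl)
  have hTm := measurable_gradientMap h (biTransform h S ψ)
  have hopt := hψ.isOptimalMap hh hh0 hS hne hμ hν hac
  have hms : MeasurableSet {z : Space d × Space d |
      biTransform h S ψ z.1 + infTransform (reflect h) S ψ z.2 = h (z.1 - z.2)} := by
    have := hl.continuous
    exact (isClosed_eq (by fun_prop) (by fun_prop)).measurableSet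
  -- Tightness along the gradient map makes the dual value equal to the optimal cost, which in turn
  -- forces `γ` to be tight.
  obtain ⟨hD, hcost⟩ := hopt.2.1.planCost_eq_of_contact hS hμ hν' hc hh0 hl.continuous hφ
    ((ae_map_iff (aemeasurable_id'.prodMk hTm.aemeasurable) hms).2 (by
      filter_upwards [hd] with x hx using (hψ.1.1.contact hh hS hne hx).2.1))
  have hcontact := hγ.1.ae_contact hS hμ hν' hc hh0 hl.continuous hφ
    (fun x _ y hy => biTransform_add_conj_le hconv hS hne hb x hy) hD
    ((hγ.2 _ hopt.2.1).trans hcost.le)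
  refine hγ.1.eq_mapPlan hTm ?_
  filter_upwards [hcontact, hγ.1.ae_fst hd, hγ.1.ae_snd (show ∀ᵐ x ∂ν, x ∈ closure S from hν')]
    with z hz hzd hzS
  -- A contact pair says that `z.2` is a minimizer at `z.1`; at a point of differentiability only
  -- the gradient map is one.
  refine (eq_gradientMap_of_isSubgradient hh (isSubgradient_gradient_infTransform hconv hS hφ hzS
    ?_ hzd)).symm
  have hz' : infTransform h S (infTransform (reflect h) S ψ) z.1
      + infTransform (reflect h) S ψ z.2 = h (z.1 - z.2) := hz
  linarith

/-- The link between an optimal map and an arbitrary Kantorovich potential. -/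
theorem IsKantorovichPotential.ae_link
    (hψ : IsKantorovichPotential S (diffCost h) μ ν ψ) (hh : StrictConvexOn ℝ univ h)
    (hh0 : ∀ z, 0 ≤ h z) (hSm : MeasurableSet S) (hS : Bornology.IsBounded S)
    (hne : S.Nonempty) (hμ : μ Sᶜ = 0) (hν : ν Sᶜ = 0) (hac : μ ≪ volume)
    {T : Space d → Space d} (hT : IsOptimalMap (diffCost h) μ ν T) :
    ∀ᵐ x ∂μ, x ∈ S ∧ DifferentiableAt ℝ (biTransform h S ψ) x ∧ DifferentiableWithinAt ℝ ψ S x ∧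
      gradientWithin ψ S x = ∇ (biTransform h S ψ) x ∧
      T x = gradientMap h (biTransform h S ψ) x ∧ IsSubgradient h (gradientWithin ψ S x) (x - T x)
        ∧ (ψ x : EReal) + cConj S (diffCost h) ψ (T x) = (diffCost h x (T x) : ℝ) := by
  have hb := hψ.1.1.bddAbove hh.convexOn.locallyLipschitz.continuous hS hne
  filter_upwards [hψ.1.1.ae_gradientWithin hh.convexOn hSm hS hne hμ hac,
    ae_eq_of_mapPlan_eq (measurable_gradientMap h _) hT.1
      (hψ.eq_mapPlan hh hh0 hS hne hμ hν hac hT.2)] with x hx hTx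
  obtain ⟨hxS, hd, hdw, hg⟩ := hx
  obtain ⟨-, h2, h3⟩ := hψ.1.1.contact hh hS hne hd
  rw [← hTx] at h2 h3
  refine ⟨hxS, hd, hdw, hg, hTx, by rwa [hg], ?_⟩
  rw [cConj_eq hh.convexOn hS hne hb, hψ.1.1.eq_infTransform hh.convexOn hS hne hxS, diffCost]
  exact_mod_cast h2

end Potential

end Optimality

/-! ### The quadratic cost and gradients of convex functions. -/

section Quadratic

theorem hasGradientAt_quadratic (x : Space d) : HasGradientAt (quadratic (d := d)) x x := by
  have h1 : HasFDerivAt (fun x : Space d => ‖x‖ ^ 2) (2 • innerSL ℝ x) x :=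
    (hasStrictFDerivAt_norm_sq x).hasFDerivAt
  rw [hasGradientAt_iff_hasFDerivAt]
  have h2 := h1.const_mul (1 / 2 : ℝ)
  have e : (fun x : Space d => (1 / 2 : ℝ) * ‖x‖ ^ 2) = quadratic := by
    ext x; rw [quadratic]; ring
  rw [e] at h2
  convert! h2 using 1
  ext v
  simp

theorem quadratic_nonneg (z : Space d) : 0 ≤ quadratic z := by
  rw [quadratic]; positivity

/-- The exact convexity defect depends only on `x - y`. It yields strict convexity, and it cancels
in the convexity of `|x|²/2` minus a transform. -/
theorem quadratic_combo (x y : Space d) {a b : ℝ} (hab : a + b = 1) :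
    quadratic (a • x + b • y) = a * quadratic x + b * quadratic y - a * b * quadratic (x - y) := by
  simp only [quadratic, norm_add_sq_real, norm_sub_sq_real, norm_smul, inner_smul_left,
    inner_smul_right, mul_pow, Real.norm_eq_abs, sq_abs, RCLike.conj_to_real]
  obtain rfl : b = 1 - a := by linarith
  ring

theorem quadratic_sub (x y : Space d) :
    quadratic (x - y) = quadratic x - inner ℝ x y + quadratic y := by
  simp only [quadratic, norm_sub_sq_real]
  ring

theorem strictConvexOn_quadratic : StrictConvexOn ℝ univ (quadratic (d := d)) := by
  refine ⟨convex_univ, fun x _ y _ hxy a b ha hb hab => ?_⟩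
  rw [quadratic_combo x y hab, smul_eq_mul, smul_eq_mul]
  have : 0 < quadratic (x - y) := by
    rw [quadratic]
    have := norm_pos_iff.2 (sub_ne_zero.2 hxy)
    positivity
  have := mul_pos (mul_pos ha hb) this
  linarith

variable {S : Set (Space d)} {μ ν : Measure (Space d)} {ψ : Space d → ℝ}

/-- For the quadratic cost, subtracting a transform from `|x|²/2` gives a convex function. -/
theorem convexOn_quadratic_sub_infTransform (hS : Bornology.IsBounded S) (hne : S.Nonempty)
    {f : Space d → ℝ} (hf : BddAbove (f '' S)) :
    ConvexOn ℝ univ fun x => quadratic x - infTransform quadratic S f x := by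
  have hc := (strictConvexOn_quadratic (d := d)).convexOn.locallyLipschitz.continuous
  refine ⟨convex_univ, fun x _ y _ a b ha hb hab => ?_⟩
  have key : a * infTransform quadratic S f x + b * infTransform quadratic S f y
      - a * b * quadratic (x - y) ≤ infTransform quadratic S f (a • x + b • y) := by
    refine le_infTransform hne fun w hw => ?_
    have h1 := mul_le_mul_of_nonneg_left (infTransform_le hc hS hf x hw) ha
    have h2 := mul_le_mul_of_nonneg_left (infTransform_le hc hS hf y hw) hb
    have e1 : a • x + b • y - w = a • (x - w) + b • (y - w) := by
      have : w = (a + b) • w := by rw [hab, one_smul]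
      nth_rewrite 1 [this]
      module
    -- The difference of `x - w` and `y - w` is `x - y`, so the defect is the same for every
    -- competitor `w`.
    rw [e1, quadratic_combo _ _ hab, sub_sub_sub_cancel_right]
    have e2 : f w = a * f w + b * f w := by rw [← add_mul, hab, one_mul]
    rw [e2]
    linarith
  simp only [smul_eq_mul]
  rw [quadratic_combo x y hab]
  linarith

/-- Gradients of convex functions are optimal for the quadratic cost. -/
theorem isOptimalMap_gradient_of_convexOn [IsProbabilityMeasure μ] (hS : Bornology.IsBounded S)
    (hne : S.Nonempty) (hμ : μ Sᶜ = 0) (hac : μ ≪ volume) {φ : Space d → ℝ}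
    (hφ : ConvexOn ℝ univ φ) (hν : (μ.map (∇ φ)) Sᶜ = 0) :
    IsOptimalMap (diffCost quadratic) μ (μ.map (∇ φ)) (∇ φ) := by
  have hq := (strictConvexOn_quadratic (d := d)).convexOn
  have hqc := hq.locallyLipschitz.continuous
  have hφc := hφ.locallyLipschitz.continuous
  have hTS : ∀ᵐ x ∂μ, ∇ φ x ∈ S :=
    ae_of_ae_map (measurable_gradient φ).aemeasurable
      (show ∀ᵐ y ∂(μ.map (∇ φ)), y ∈ S from hν)
  set u : Space d → ℝ := fun x => quadratic x - φ x with hu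
  have huc : Continuous u := hqc.sub hφc
  have hub := bddAbove_image_of_continuous hS huc
  have hle : ∀ x ∈ S, ∀ y, u x + infTransform (reflect quadratic) S u y ≤ quadratic (x - y) := by
    intro x hx y
    have := infTransform_le (convexOn_reflect hq).locallyLipschitz.continuous hS hub y hx
    rw [reflect_sub] at this
    linarith
  refine isOptimalMap_of_contact hS hμ hqc quadratic_nonneg huc (continuous_conj hq hS hne hub)
    (fun x hx y _ => hle x hx y) (measurable_gradient φ).aemeasurable
    (hTS.mono fun x hx => subset_closure hx) ?_
  filter_upwards [(show ∀ᵐ x ∂μ, x ∈ S from hμ),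
    hac.ae_le (ae_differentiableAt_of_locallyLipschitz volume hφ.locallyLipschitz)] with x hxS hd
  refine le_antisymm (hle x hxS _) ?_
  -- Up to a constant, the function of `z` being minimized is `φ z - ⟨z, ∇φ(x)⟩`; the subgradient
  -- inequality for `φ` says that `x` is a minimizer.
  rw [add_comm, ← sub_le_iff_le_add]
  refine le_infTransform hne fun z _ => ?_
  have hsub : IsSubgradient φ (∇ φ x) x :=
    isSubgradient_of_touching hφ hd.hasGradientAt fun v => le_rfl
  have h1 := hsub (z - x)
  rw [add_sub_cancel, inner_sub_right, real_inner_comm z, real_inner_comm x] at h1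
  rw [reflect_sub, quadratic_sub, quadratic_sub]
  simp only [hu]
  linarith

end Quadratic

end

end OptTransport

/-! ### The main theorem. -/

open OptTransport Filter Topology

theorem mainTheorem2 {d : ℕ} (Ω : Set (OptTransport.Space d))
    (hΩ : OptTransport.IsTransportDomain Ω)
    (h : OptTransport.Space d → ℝ) (h_convex : StrictConvexOn ℝ Set.univ h)
    (h_nonneg : ∀ z, 0 ≤ h z)
    (μ ν : Measure (OptTransport.Space d)) [IsProbabilityMeasure μ] [IsProbabilityMeasure ν]
    (hμ : μ Ωᶜ = 0) (hν : ν Ωᶜ = 0) :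
    -- an optimal plan exists
    (∃ γ, OptTransport.IsOptimalPlan (OptTransport.diffCost h) μ ν γ) ∧
    (Bornology.IsBounded Ω →
      -- a Kantorovich potential exists
      (∃ ψ, OptTransport.IsKantorovichPotential Ω (OptTransport.diffCost h) μ ν ψ) ∧
      (μ ≪ volume →
        ∃ T : OptTransport.Space d → OptTransport.Space d, Measurable T ∧
          -- the optimal plan is unique and induced by `T`
          OptTransport.IsOptimalMap (OptTransport.diffCost h) μ ν T ∧
          (∀ γ, OptTransport.IsOptimalPlan (OptTransport.diffCost h) μ ν γ →
            γ = OptTransport.mapPlan μ T) ∧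
          -- link between `T` and every Kantorovich potential
          (∀ ψ, OptTransport.IsKantorovichPotential Ω (OptTransport.diffCost h) μ ν ψ →
            ∀ᵐ x ∂μ, DifferentiableWithinAt ℝ ψ Ω x ∧
              gradientWithin ψ Ω x ∈ interior (OptTransport.legendreDom h) ∧
              DifferentiableAt ℝ (OptTransport.legendre h) (gradientWithin ψ Ω x) ∧
              T x = x - ∇ (OptTransport.legendre h) (gradientWithin ψ Ω x) ∧
              (ψ x : EReal) + OptTransport.cConj Ω (OptTransport.diffCost h) ψ (T x)
                = (OptTransport.diffCost h x (T x) : ℝ)) ∧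
          -- the gradient of the potential is unique wherever `h` is differentiable at `x - T x`
          (∀ ψ₁ ψ₂, OptTransport.IsKantorovichPotential Ω (OptTransport.diffCost h) μ ν ψ₁ →
            OptTransport.IsKantorovichPotential Ω (OptTransport.diffCost h) μ ν ψ₂ →
            ∀ᵐ x ∂μ, DifferentiableAt ℝ h (x - T x) →
              gradientWithin ψ₁ Ω x = gradientWithin ψ₂ Ω x) ∧
          -- the potential is unique up to constants if the density of `μ` is positive a.e. on `Ω`
          ((∀ᵐ x ∂μ, DifferentiableAt ℝ h (x - T x)) → volume.restrict Ω ≪ μ →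
            ∀ ψ₁ ψ₂, OptTransport.IsKantorovichPotential Ω (OptTransport.diffCost h) μ ν ψ₁ →
              OptTransport.IsKantorovichPotential Ω (OptTransport.diffCost h) μ ν ψ₂ →
              ∃ C : ℝ, ∀ x ∈ Ω, ψ₁ x = ψ₂ x + C)) ∧
      -- converse: maps of this form are optimal between `μ` and their image measure
      (∀ (ψ : OptTransport.Space d → ℝ) (T : OptTransport.Space d → OptTransport.Space d),
        OptTransport.IsCConcave Ω (OptTransport.diffCost h) ψ →
        (μ ≪ volume ∨ ∀ᵐ x ∂μ, x ∈ interior Ω ∧ DifferentiableAt ℝ ψ x) →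
        (∀ᵐ x ∂μ, T x = x - ∇ (OptTransport.legendre h) (gradientWithin ψ Ω x)) →
        OptTransport.IsOptimalMap (OptTransport.diffCost h) μ (μ.map T) T) ∧
      -- Brenier's theorem: the quadratic cost
      (μ ≪ volume →
        ∃ φ : OptTransport.Space d → ℝ, ConvexOn ℝ Set.univ φ ∧
          OptTransport.IsOptimalMap (OptTransport.diffCost OptTransport.quadratic) μ ν (∇ φ) ∧
          (∃ ψ, OptTransport.IsKantorovichPotential Ω
              (OptTransport.diffCost OptTransport.quadratic) μ ν ψ ∧
            ∀ x ∈ Ω, φ x = ‖x‖ ^ 2 / 2 - ψ x) ∧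
          (∀ ψ, OptTransport.IsKantorovichPotential Ω
              (OptTransport.diffCost OptTransport.quadratic) μ ν ψ →
            ∀ᵐ x ∂μ, ∇ φ x = x - gradientWithin ψ Ω x) ∧
          (∀ φ' : OptTransport.Space d → ℝ, ConvexOn ℝ Set.univ φ' → μ.map (∇ φ') = ν →
            ∀ᵐ x ∂μ, ∇ φ' x = ∇ φ x))) := by
  have hconv := h_convex.convexOn
  have hc := hconv.locallyLipschitz.continuous
  have hne : Ω.Nonempty := hΩ.connected.nonempty.mono interior_subset
  have hm := hΩ.measurableSet
  refine ⟨exists_isOptimalPlan (c := diffCost h) (hc.comp (by fun_prop)) μ ν, fun hb => ?_⟩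
  refine ⟨exists_isKantorovichPotential hconv hb hne hμ hν, fun hac => ?_,
    fun ψ T hψ hreg hT => ?_, fun hac => ?_⟩
  · obtain ⟨ψ₀, hψ₀⟩ := exists_isKantorovichPotential (μ := μ) (ν := ν) hconv hb hne hμ hν
    set T := gradientMap h (biTransform h Ω ψ₀)
    have hTopt : IsOptimalMap (diffCost h) μ ν T :=
      hψ₀.isOptimalMap h_convex h_nonneg hb hne hμ hν hac
    have hlink := fun {ψ : Space d → ℝ} (hψ : IsKantorovichPotential Ω (diffCost h) μ ν ψ) =>
      hψ.ae_link h_convex h_nonneg hm hb hne hμ hν hac hTopt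
    have hgrad : ∀ ψ₁ ψ₂, IsKantorovichPotential Ω (diffCost h) μ ν ψ₁ →
        IsKantorovichPotential Ω (diffCost h) μ ν ψ₂ →
        ∀ᵐ x ∂μ, DifferentiableAt ℝ h (x - T x) →
          gradientWithin ψ₁ Ω x = gradientWithin ψ₂ Ω x := by
      intro ψ₁ ψ₂ h₁ h₂
      filter_upwards [hlink h₁, hlink h₂] with x hx₁ hx₂ hd
      obtain ⟨-, -, -, -, -, hs₁, -⟩ := hx₁
      obtain ⟨-, -, -, -, -, hs₂, -⟩ := hx₂
      -- Both gradients are subgradients of `h` at the same point `x - T x`, because `T` does not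
      -- depend on the potential.
      rw [hs₁.eq_gradient hd, hs₂.eq_gradient hd]
    refine ⟨T, measurable_gradientMap _ _, hTopt, fun γ hγ =>
      hψ₀.eq_mapPlan h_convex h_nonneg hb hne hμ hν hac hγ, fun ψ hψ => ?_, hgrad, ?_⟩
    · filter_upwards [hlink hψ] with x hx
      obtain ⟨-, -, hdw, hg, hTx, hs, hcontact⟩ := hx
      obtain ⟨hint, hleg⟩ := hs.legendre h_convex
      exact ⟨hdw, hint, hleg.differentiableAt, by rw [hg, hTx, gradientMap], hcontact⟩
    · intro hdiff hpos ψ₁ ψ₂ h₁ h₂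
      have hl₁ := locallyLipschitz_biTransform hconv hb hne (h₁.1.1.bddAbove hc hb hne)
      have hl₂ := locallyLipschitz_biTransform hconv hb hne (h₂.1.1.bddAbove hc hb hne)
      have hz : ∀ᵐ x ∂μ, HasFDerivAt (fun x => biTransform h Ω ψ₁ x - biTransform h Ω ψ₂ x)
          (0 : Space d →L[ℝ] ℝ) x := by
        filter_upwards [hlink h₁, hlink h₂, hdiff, hgrad ψ₁ ψ₂ h₁ h₂] with x hx₁ hx₂ hd hg
        obtain ⟨-, hd₁, -, hg₁, -⟩ := hx₁
        obtain ⟨-, hd₂, -, hg₂, -⟩ := hx₂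
        have e : fderiv ℝ (biTransform h Ω ψ₁) x = fderiv ℝ (biTransform h Ω ψ₂) x := by
          rw [← toDual_gradient, ← toDual_gradient, ← hg₁, ← hg₂, hg hd]
        have := hd₁.hasFDerivAt.sub hd₂.hasFDerivAt
        rwa [e, sub_self] at this
      obtain ⟨C, hC⟩ := exists_eq_const_of_ae_hasFDerivAt_zero volume
        (hl₁.sub hl₂) isOpen_interior hΩ.connected.isPreconnected (by
          filter_upwards [(ae_restrict_iff' hm).1 (hpos.ae_le hz)] with x hx hxi
          exact hx (interior_subset hxi))
      refine ⟨C, fun x hx => ?_⟩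
      -- Equality on the interior passes to `Ω` by continuity of the extensions, since `Ω` lies in
      -- the closure of its interior.
      have hcl : IsClosed {x | biTransform h Ω ψ₁ x - biTransform h Ω ψ₂ x = C} :=
        isClosed_eq (hl₁.continuous.sub hl₂.continuous) continuous_const
      have h3 : biTransform h Ω ψ₁ x - biTransform h Ω ψ₂ x = C :=
        closure_minimal (s := interior Ω) (fun y hy => hC y hy) hcl (hΩ.subset_closure hx)
      rw [h₁.1.1.eq_infTransform hconv hb hne hx, h₂.1.1.eq_infTransform hconv hb hne hx]
      rw [biTransform, biTransform] at h3
      linarith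
  · have hreg' : ∀ᵐ x ∂μ, DifferentiableAt ℝ (biTransform h Ω ψ) x ∧
        gradientWithin ψ Ω x = ∇ (biTransform h Ω ψ) x := by
      rcases hreg with hac | hreg
      · filter_upwards [hψ.ae_gradientWithin hconv hm hb hne hμ hac] with x hx
        exact ⟨hx.2.1, hx.2.2.2⟩
      · filter_upwards [hreg] with x hx
        have hnhds : Ω ∈ 𝓝 x := mem_interior_iff_mem_nhds.1 hx.1
        -- At interior points the extension coincides with `ψ` nearby, so differentiability is
        -- inherited without absolute continuity of `μ`.
        have hev : biTransform h Ω ψ =ᶠ[𝓝 x] ψ := by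
          filter_upwards [hnhds] with y hy
          exact (hψ.eq_infTransform hconv hb hne hy).symm
        refine ⟨hx.2.congr_of_eventuallyEq hev, ?_⟩
        rw [hev.gradient_eq, gradientWithin, fderivWithin_of_mem_nhds hnhds, gradient]
    refine hψ.isOptimalMap h_convex h_nonneg hb hne hμ (hreg'.mono fun x hx => hx.1) ?_
    filter_upwards [hT, hreg'] with x hTx hx
    rw [hTx, hx.2, gradientMap]
  · have hq := strictConvexOn_quadratic (d := d)
    obtain ⟨ψ₀, hψ₀⟩ := exists_isKantorovichPotential (μ := μ) (ν := ν) hq.convexOn hb hne hμ hν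
    set T := gradientMap quadratic (biTransform quadratic Ω ψ₀) with hTdef
    have hTopt : IsOptimalMap (diffCost quadratic) μ ν T :=
      hψ₀.isOptimalMap hq quadratic_nonneg hb hne hμ hν hac
    have hb₀ := hψ₀.1.1.bddAbove hq.convexOn.locallyLipschitz.continuous hb hne
    have hlink : ∀ ψ, IsKantorovichPotential Ω (diffCost quadratic) μ ν ψ →
        ∀ᵐ x ∂μ, DifferentiableAt ℝ (biTransform quadratic Ω ψ) x ∧
          gradientWithin ψ Ω x = ∇ (biTransform quadratic Ω ψ) x ∧
          T x = x - gradientWithin ψ Ω x := by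
      intro ψ hψ
      filter_upwards [hψ.ae_link hq quadratic_nonneg hm hb hne hμ hν hac hTopt] with x hx
      obtain ⟨-, hd, -, hg, -, hs, -⟩ := hx
      refine ⟨hd, hg, ?_⟩
      -- The subgradient of `|z|²/2` at `z = x - T x` is `z` itself, so `h*` need not be computed.
      rw [hs.eq_gradient (hasGradientAt_quadratic _).differentiableAt,
        (hasGradientAt_quadratic _).gradient]
      abel
    let φ : Space d → ℝ := fun x => quadratic x - biTransform quadratic Ω ψ₀ x
    have hφT : ∇ φ =ᵐ[μ] T := by
      filter_upwards [hlink ψ₀ hψ₀] with x hx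
      obtain ⟨hd, hg, hTx⟩ := hx
      have h1 : HasGradientAt φ (x - ∇ (biTransform quadratic Ω ψ₀) x) x := by
        rw [hasGradientAt_iff_hasFDerivAt, map_sub]
        exact (hasGradientAt_quadratic x).hasFDerivAt.sub hd.hasGradientAt.hasFDerivAt
      rw [h1.gradient, hTx, hg]
    have hφplan : mapPlan μ (∇ φ) = mapPlan μ T :=
      Measure.map_congr (by filter_upwards [hφT] with x hx; rw [hx])
    refine ⟨φ, convexOn_quadratic_sub_infTransform hb hne
      (bddAbove_image_reflect_infTransform hq.convexOn hb hne hb₀),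
      ⟨(measurable_gradient φ).aemeasurable, by rw [hφplan]; exact hTopt.2⟩,
      ⟨ψ₀, hψ₀, fun x hx => ?_⟩, fun ψ hψ => ?_, fun φ' hφ' hmap => ?_⟩
    · rw [hψ₀.1.1.eq_infTransform hq.convexOn hb hne hx]
      rfl
    · filter_upwards [hφT, hlink ψ hψ] with x hx₁ hx₂
      rw [hx₁, hx₂.2.2]
    · have hopt' := isOptimalMap_gradient_of_convexOn hb hne hμ hac hφ' (by rw [hmap, hν])
      rw [hmap] at hopt'
      have heq := ae_eq_of_mapPlan_eq (measurable_gradientMap _ _) hopt'.1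
        (hψ₀.eq_mapPlan hq quadratic_nonneg hb hne hμ hν hac hopt'.2)
      filter_upwards [heq, hφT] with x hx₁ hx₂
      rw [hx₁, hx₂]
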